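/- **Theorem 3.1.** Let $m$ be a natural number and consider the Nicholson system $$y_i'(t)=-\tilde d_i(t)\,y_i(t)+\sum_{j=1}^m\tilde a_{ij}(t)\,y_j(t)+\tilde\beta_i(t)\,y_i(t-r_i)\,e^{-\tilde c_i(t)\,y_i(t-r_i)},\qquad t\ge 0,\quad i=1,\dots,m,$$ with delays $r_i>0$ and coefficients $\mathbb R\to\mathbb R$ satisfying: * (a1) all $\tilde d_i,\tilde a_{ij},\tilde c_i,\tilde\beta_i$ are almost periodic, i.e. continuous and such that for every $\varepsilon>0$ the set of $s\in\mathbb R$ with $|h(t+s)-h(t)|<\varepsilon$ for all $t\in\mathbb R$ is relatively dense, where $h$ is the coefficient; * (a2) there is $d_0>0$ with $\tilde d_i(t)\ge d_0$ for all $t\in\mathbb R$ and all $i$; * (a3) $\tilde a_{ij}(t)\ge 0$ and $\tilde a_{ii}(t)=0$ for all $t\in\mathbb R$ and all $i,j$; * (a4) $\tilde\beta_i(t)>0$ for all $t\in\mathbb R$ and all $i$; * (a5) there is $c_0>0$ with $\tilde c_i(t)\ge c_0$ for all $t\in\mathbb R$ and all $i$; * (a6) $\tilde d_i(t)-\sum_{j=1}^m\tilde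 a_{ji}(t)>0$ for all $t\in\mathbb R$ and all $i$. Let $\Omega$ be the hull of $l=(\tilde d_i,\tilde a_{ij},\tilde\beta_i,\tilde c_i)$, that is, the closure of the set of its time-translates $s\mapsto l(t+s)$, $t\in\mathbb R$, for the compact-open topology, with a metric inducing the uniformity of uniform convergence on compact sets, and with the shift $(\omega\cdot t)(s)=\omega(t+s)$. Define $d_i,a_{ij},\beta_i,c_i$ on $\Omega$ by $(d_i(\omega),a_{ij}(\omega),\beta_i(\omega),c_i(\omega))=\omega(0)$. Let $X=C([-r_1,0])\times\dots\times C([-r_m,0])$ with the supremum norm and $X_+=\{\varphi\in X\mid\varphi_i(s)\ge 0\text{ for all }i\text{ and } s\in[-r_i,0]\}$. For $\omega\in\Omega$ and $\varphi\in X_+$ let $y(t,\omega,\varphi)$ denote the solution of $$y_i'(t)=-d_i(\omega\cdot t)\,y_i(t)+\sum_{j=1}^m a_{ij}(\omega\cdot t)\,y_j(t)+\beta_i(\omega\cdot t)\,y_i(t-r_i)\,e^{-c_i(\omega\cdot t)\,y_i(t-r_i)},\qquad t\ge 0,\quad i=1,\dots,m,$$ with initial value $y_i(s)=\varphi_i(s)$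 for $s\in[-r_i,0]$, and let $(y_t(\omega,\varphi))_i(s)=y_i(t+s,\omega,\varphi)$ for $s\in[-r_i,0]$. Then these solutions exist on $[0,\infty)$, are unique and remain in $X_+$; $\Omega$ is compact, the shift is a continuous flow on it, and $$\tau(t,\omega,\varphi)=(\omega\cdot t,\,y_t(\omega,\varphi))$$ defines a continuous skew-product semiflow $\tau:\mathbb R_+\times\Omega\times X_+\to\Omega\times X_+$. Moreover, $\tau$ has a global attractor with respect to the class of bounded subsets of $X_+$: there is a compact set $\mathcal A\subset\Omega\times X_+$ such that $\tau_t(\mathcal A)=\mathcal A$ for all $t\ge 0$ and $$\lim_{t\to\infty}\operatorname{dist}\big(\tau_t(\Omega\times X_1),\mathcal A\big)=0\qquad\text{for every bounded } X_1\subset X_+,$$ where $\operatorname{dist}(B,A)=\sup_{b\in B}\inf_{a\in A}\mathsf d(b,a)$ is the Hausdorff semidistance. -/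

import Mathlib

open Set Filter Topology
open scoped NNReal ENNReal

/-! ## Non-autonomous dynamics -/

/-- A set of reals is relatively dense if some length `L` exists such that every closed interval of
length `L` meets it. -/
def RelativelyDense (P : Set ℝ) : Prop :=
  ∃ L : ℝ, 0 < L ∧ ∀ a : ℝ, ∃ s ∈ P, a ≤ s ∧ s ≤ a + L

/-- Almost periodicity of a real function: continuity, and relative density of the set of
`ε`-periods for every `ε > 0`. -/
def IsAlmostPeriodic (h : ℝ → ℝ) : Prop :=
  Continuous h ∧ ∀ ε : ℝ, 0 < ε → RelativelyDense {s : ℝ | ∀ t : ℝ, |h (t + s) - h t| < ε}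

/-- A real continuous flow. -/
structure IsContinuousFlow {Ω : Type*} [TopologicalSpace Ω] (σ : ℝ → Ω → Ω) : Prop where
  continuous : Continuous fun p : ℝ × Ω => σ p.1 p.2
  zero : ∀ ω, σ 0 ω = ω
  add : ∀ t s ω, σ (t + s) ω = σ t (σ s ω)

/-- A continuous skew-product semiflow `τ` on `Ω × X` over a continuous flow `σ` on a compact
metric base `Ω`. -/
structure IsSkewProductSemiflow {Ω X : Type*} [MetricSpace Ω] [MetricSpace X]
    (σ : ℝ → Ω → Ω) (τ : ℝ≥0 → Ω × X → Ω × X) : Prop where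
  compact_base : CompactSpace Ω
  base_flow : IsContinuousFlow σ
  continuous : Continuous fun p : ℝ≥0 × (Ω × X) => τ p.1 p.2
  fst_eq : ∀ t p, (τ t p).1 = σ (t : ℝ) p.1
  zero : ∀ p, τ 0 p = p
  add : ∀ t s p, τ (t + s) p = τ t (τ s p)

/-- The Hausdorff semidistance `sup_{b ∈ B} inf_{a ∈ A} dist b a`, with values in `[0, ∞]`
(the infimum over the empty set being `∞`). -/
noncomputable def hausdorffSemidist {Y : Type*} [PseudoEMetricSpace Y] (B A : Set Y) : ℝ≥0∞ :=
  ⨆ b ∈ B, ⨅ a ∈ A, edist b a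

/-- `A` is a global attractor for `τ` with respect to the class `D` of subsets of `X`: it is
compact, `τ`-invariant, and attracts `Ω × X₁` forwards in time for every `X₁ ∈ D`. -/
structure IsGlobalAttractor {Ω X : Type*} [MetricSpace Ω] [MetricSpace X]
    (τ : ℝ≥0 → Ω × X → Ω × X) (D : Set (Set X)) (A : Set (Ω × X)) : Prop where
  compact : IsCompact A
  invariant : ∀ t, τ t '' A = A
  attracts : ∀ X₁ ∈ D,
    Tendsto (fun t => hausdorffSemidist (τ t '' (univ ×ˢ X₁)) A) atTop (𝓝 0)

/-! ## Nicholson systems -/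

/-- The data of an `m`-dimensional Nicholson system
`yᵢ'(t) = -dᵢ(t) yᵢ(t) + ∑ⱼ aᵢⱼ(t) yⱼ(t) + βᵢ(t) yᵢ(t - rᵢ) exp (-cᵢ(t) yᵢ(t - rᵢ))`
with continuous coefficients and positive delays. -/
structure NicholsonSystem (m : ℕ) where
  r : Fin m → ℝ
  r_pos : ∀ i, 0 < r i
  d : Fin m → C(ℝ, ℝ)
  a : Fin m → Fin m → C(ℝ, ℝ)
  β : Fin m → C(ℝ, ℝ)
  c : Fin m → C(ℝ, ℝ)

/-- The finite-dimensional space of all coefficient values `(dᵢ, aᵢⱼ, βᵢ, cᵢ)`. -/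
abbrev NicholsonCoeff (m : ℕ) : Type :=
  (Fin m → ℝ) × (Fin m → Fin m → ℝ) × (Fin m → ℝ) × (Fin m → ℝ)

namespace NicholsonSystem

variable {m : ℕ} (S : NicholsonSystem m)

/-- The standing assumptions on the coefficients. -/
structure Assumptions (S : NicholsonSystem m) : Prop where
  almostPeriodic_d : ∀ i, IsAlmostPeriodic (S.d i)
  almostPeriodic_a : ∀ i j, IsAlmostPeriodic (S.a i j)
  almostPeriodic_β : ∀ i, IsAlmostPeriodic (S.β i)
  almostPeriodic_c : ∀ i, IsAlmostPeriodic (S.c i)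
  d_lower : ∃ d₀ : ℝ, 0 < d₀ ∧ ∀ i t, d₀ ≤ S.d i t
  a_nonneg : ∀ i j t, 0 ≤ S.a i j t
  a_diag : ∀ i t, S.a i i t = 0
  β_pos : ∀ i t, 0 < S.β i t
  c_lower : ∃ c₀ : ℝ, 0 < c₀ ∧ ∀ i t, c₀ ≤ S.c i t
  dominance : ∀ i t, 0 < S.d i t - ∑ j, S.a j i t

/-- The map `t ↦ (dᵢ(t), aᵢⱼ(t), βᵢ(t), cᵢ(t))` of all the coefficients. -/
def coeffMap : C(ℝ, NicholsonCoeff m) where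
  toFun t := (fun i => S.d i t, fun i j => S.a i j t, fun i => S.β i t, fun i => S.c i t)
  continuous_toFun := by fun_prop

/-- The time-translate `s ↦ f (t + s)`. -/
def translate (t : ℝ) (f : C(ℝ, NicholsonCoeff m)) : C(ℝ, NicholsonCoeff m) :=
  f.comp ⟨fun s => t + s, by fun_prop⟩

theorem continuous_translate (t : ℝ) :
    Continuous (translate t : C(ℝ, NicholsonCoeff m) → C(ℝ, NicholsonCoeff m)) :=
  ContinuousMap.continuous_precomp _

theorem translate_translate (t s : ℝ) (f : C(ℝ, NicholsonCoeff m)) :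
    translate t (translate s f) = translate (s + t) f := by
  ext1 u
  simp [translate, add_assoc]

/-- The hull as a set: the closure, for the compact-open topology, of the time-translates of the
coefficient map. -/
def hullSet : Set C(ℝ, NicholsonCoeff m) :=
  closure (range fun t : ℝ => translate t S.coeffMap)

theorem translate_mem_hullSet (t : ℝ) {f : C(ℝ, NicholsonCoeff m)} (hf : f ∈ S.hullSet) :
    translate t f ∈ S.hullSet := by
  refine map_mem_closure (continuous_translate t) hf ?_
  rintro _ ⟨s, rfl⟩
  exact ⟨s + t, (translate_translate t s _).symm⟩

/-- The hull `Ω` of the system. -/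
def Hull : Type := S.hullSet

/-- The uniformity of compact convergence, whose topology is the compact-open one. -/
instance : UniformSpace S.Hull := inferInstanceAs (UniformSpace S.hullSet)

instance : (uniformity S.Hull).IsCountablyGenerated :=
  inferInstanceAs ((uniformity S.hullSet).IsCountablyGenerated)

instance : T0Space S.Hull := inferInstanceAs (T0Space S.hullSet)

/-- A metric on the hull inducing exactly the uniformity of compact convergence, hence the
compact-open topology. Which compatible metric is taken plays no role for convergence of
semidistances to zero. -/
noncomputable instance : MetricSpace S.Hull := UniformSpace.metricSpace S.Hull

/-- The shift flow `(ω · t)(s) = ω (t + s)` on the hull. -/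
def shift (t : ℝ) (ω : S.Hull) : S.Hull :=
  ⟨translate t ω.1, S.translate_mem_hullSet t ω.2⟩

/-- The coefficients `dᵢ`, `aᵢⱼ`, `βᵢ`, `cᵢ` as functions on the hull are the components of
`ω ↦ ω 0`; this is `dᵢ`. -/
def hullD (i : Fin m) (ω : S.Hull) : ℝ := (ω.1 0).1 i

/-- The coefficient `aᵢⱼ` on the hull. -/
def hullA (i j : Fin m) (ω : S.Hull) : ℝ := (ω.1 0).2.1 i j

/-- The coefficient `βᵢ` on the hull. -/
def hullB (i : Fin m) (ω : S.Hull) : ℝ := (ω.1 0).2.2.1 i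

/-- The coefficient `cᵢ` on the hull. -/
def hullC (i : Fin m) (ω : S.Hull) : ℝ := (ω.1 0).2.2.2 i

/-- The state space `X = C([-r₁, 0]) × ⋯ × C([-rₘ, 0])` with the supremum norm. -/
abbrev StateSpace : Type := ∀ i : Fin m, C(Icc (-S.r i) 0, ℝ)

/-- The positive cone `X₊` of the state space. -/
abbrev PosCone : Type := {φ : S.StateSpace // ∀ i s, 0 ≤ φ i s}

/-- `y` is a solution on `[0, ∞)` of the system attached to `ω`, with initial value `φ`. Only the
values of `y i` on `[-rᵢ, ∞)` matter; the derivative at `0` is the right derivative. -/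
structure IsSolution (ω : S.Hull) (φ : S.StateSpace) (y : Fin m → ℝ → ℝ) : Prop where
  continuousOn : ∀ i, ContinuousOn (y i) (Ici (-S.r i))
  initial : ∀ i (s : Icc (-S.r i) 0), y i s = φ i s
  deriv : ∀ i t, 0 ≤ t → HasDerivWithinAt (y i)
    (-S.hullD i (S.shift t ω) * y i t + ∑ j, S.hullA i j (S.shift t ω) * y j t
      + S.hullB i (S.shift t ω) * y i (t - S.r i)
        * Real.exp (-S.hullC i (S.shift t ω) * y i (t - S.r i))) (Ici 0) t

/-- `τ` is the map `(t, ω, φ) ↦ (ω · t, y_t(ω, φ))` on `Ω × X₊` induced by the solutions: every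
initial value in `X₊` has a solution on `[0, ∞)`, and the second component of `τ t (ω, φ)` is the
history segment `s ↦ y (t + s)` at time `t` of any solution `y` (so solutions are unique and stay
in the positive cone). -/
structure IsInducedSemiflow (τ : ℝ≥0 → S.Hull × S.PosCone → S.Hull × S.PosCone) : Prop where
  exists_solution : ∀ (ω : S.Hull) (φ : S.PosCone), ∃ y, S.IsSolution ω φ.1 y
  base : ∀ (t : ℝ≥0) (ω : S.Hull) (φ : S.PosCone), (τ t (ω, φ)).1 = S.shift t ω
  segment : ∀ (ω : S.Hull) (φ : S.PosCone) (y : Fin m → ℝ → ℝ), S.IsSolution ω φ.1 y →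
    ∀ (t : ℝ≥0) (i : Fin m) (s : Icc (-S.r i) 0), (τ t (ω, φ)).2.1 i s = y i (t + s)

end NicholsonSystem

/-!
The positive cone is invariant and the nonlinearity `z exp (-cz)` is bounded and `1`-Lipschitz on
`[0, ∞)`, which gives the semiflow; the column dominance `dᵢ - ∑ⱼ aⱼᵢ > 0` makes the total
population `∑ yᵢ` dissipative, which gives the attractor.

*Base.* Finitely many almost periodic functions are jointly almost periodic, because the
translates of each form a totally bounded set for the uniform distance and this property passes to
products (`HasPrecompactTranslates`). It follows that the hull is compact
(`Assumptions.isCompact_hullSet`). Closed conditions on the coefficients pass to the hull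
(`Assumptions.exists_coeffBounds`).

*Semiflow.* With positive parts inserted into the coupling and delayed terms, the system has a
globally Lipschitz right-hand side, and a weighted supremum norm turns the integral equation on the
whole half-line into a contraction (`exists_delay_solution`). Its solutions are nonnegative, so they
solve the original system (`exists_isPosSolution`). The same weight gives a Grönwall inequality with
delays (`norm_le_of_norm_deriv_le_delayed`), from which uniqueness and continuous dependence on
`(ω, φ)` follow. Uniqueness gives the semigroup property.

*Attractor.* The dominance margin is positive at every time but its infimum may be zero, so it may
vanish at some points of the hull. By joint almost periodicity, however, all the margins exceed one
constant `η > 0` on intervals of a fixed length that recur within bounded times, for every `ω`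
(`Assumptions.exists_recurrent_dominance`). As the Nicholson term is bounded by `β / c₀`, the sum
`V = ∑ yᵢ` obeys `V' ≤ K` always and `V' ≤ -η V + K` on these intervals, hence
`V (t + W) ≤ q V t + C` with `q < 1` (`exists_sum_solution_window`). Solutions are thus ultimately
bounded, uniformly on bounded sets of initial values, and so are their derivatives. By
Arzelà-Ascoli there is a compact absorbing set (`exists_absorbing_lipschitzStates`), and its
`ω`-limit set is the attractor (`IsSkewProductSemiflow.exists_isGlobalAttractor`).
-/

/-! ### Global attractors from compact absorbing sets -/

section Attractor

variable {Y : Type*} [TopologicalSpace Y] [T2Space Y] {τ : ℝ≥0 → Y → Y} {K : Set Y}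

/-- The `ω`-limit set of a compact set that a continuous semiflow eventually maps into itself is
invariant. Backward invariance holds because the pre-images `τ (tₙ - t) xₙ` of a convergent
sequence `τ tₙ xₙ` stay in the compact set. -/
theorem image_omegaLimit_eq_of_isCompact (hc : ∀ t, Continuous (τ t))
    (hadd : ∀ t s p, τ (t + s) p = τ t (τ s p)) (hK : IsCompact K)
    (habs : ∀ᶠ t in atTop, MapsTo (τ t) K K) (t : ℝ≥0) :
    τ t '' omegaLimit atTop τ K = omegaLimit atTop τ K := by
  apply Subset.antisymm
  · rintro _ ⟨y, hy, rfl⟩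
    rw [mem_omegaLimit_iff_frequently] at hy ⊢
    intro n hn
    have h1 := hy _ ((hc t).continuousAt.preimage_mem_nhds hn)
    rw [frequently_atTop] at h1 ⊢
    intro a
    obtain ⟨b, hb, x, hx, hxn⟩ := h1 a
    exact ⟨t + b, le_add_left hb, x, hx, by simpa [hadd] using hxn⟩
  · intro y hy
    have hy' : MapClusterPt y (atTop ×ˢ 𝓟 K) (fun p : ℝ≥0 × Y => τ p.1 p.2) := by
      rw [mapClusterPt_iff_frequently]
      intro n hn
      rw [mem_omegaLimit_iff_frequently] at hy
      intro hcon
      rw [eventually_prod_principal_iff] at hcon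
      obtain ⟨s, ⟨x, hx, hxn⟩, hs⟩ := ((hy n hn).and_eventually hcon).exists
      exact hs x hx hxn
    rw [mapClusterPt_iff_ultrafilter] at hy'
    obtain ⟨U, hU, hUy⟩ := hy'
    have hfst : Tendsto Prod.fst (U : Filter (ℝ≥0 × Y)) atTop := tendsto_fst.mono_left hU
    have hsnd : ∀ᶠ p in (U : Filter (ℝ≥0 × Y)), p.2 ∈ K :=
      (tendsto_snd.mono_left hU).eventually (mem_principal_self K)
    have hsub : Tendsto (fun p : ℝ≥0 × Y => p.1 - t) (U : Filter (ℝ≥0 × Y)) atTop := by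
      rw [tendsto_atTop]
      intro b
      filter_upwards [hfst.eventually_ge_atTop (b + t)] with p hp
      exact le_tsub_of_add_le_right hp
    have hmem : ∀ᶠ p in (U : Filter (ℝ≥0 × Y)), τ (p.1 - t) p.2 ∈ K := by
      filter_upwards [hsub.eventually habs, hsnd] with p h1 h2 using h1 h2
    obtain ⟨z, -, hz⟩ := hK.ultrafilter_le_nhds
      (U.map fun p : ℝ≥0 × Y => τ (p.1 - t) p.2) (le_principal_iff.2 hmem)
    have hz' : Tendsto (fun p : ℝ≥0 × Y => τ (p.1 - t) p.2) U (𝓝 z) := hz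
    refine ⟨z, ?_, ?_⟩
    · rw [mem_omegaLimit_iff_frequently]
      intro n hn
      rw [frequently_atTop]
      intro a
      obtain ⟨p, h1, h2, h3⟩ := ((hz'.eventually hn).and
        ((hsub.eventually_ge_atTop a).and hsnd)).exists
      exact ⟨p.1 - t, h2, p.2, h3, h1⟩
    · refine tendsto_nhds_unique (((hc t).tendsto z).comp hz') (hUy.congr' ?_)
      filter_upwards [hfst.eventually_ge_atTop t] with p hp
      simp only [Function.comp]
      rw [← hadd, add_tsub_cancel_of_le hp]

end Attractor

theorem hausdorffSemidist_le_of_subset_thickening {Y : Type*} [PseudoEMetricSpace Y]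
    {A B : Set Y} {δ : ℝ} (h : B ⊆ Metric.thickening δ A) :
    hausdorffSemidist B A ≤ ENNReal.ofReal δ :=
  iSup₂_le fun _ hb => le_of_lt (h hb)

/-- A continuous skew-product semiflow with a compact set that absorbs `Ω × X₁` for every
`X₁` of the class `D`, and also absorbs itself, has a global attractor with respect to `D`. -/
theorem IsSkewProductSemiflow.exists_isGlobalAttractor {Ω X : Type*} [MetricSpace Ω]
    [MetricSpace X] {σ : ℝ → Ω → Ω} {τ : ℝ≥0 → Ω × X → Ω × X} (h : IsSkewProductSemiflow σ τ)
    {D : Set (Set X)} {K : Set (Ω × X)} (hK : IsCompact K)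
    (hKK : ∀ᶠ t in atTop, MapsTo (τ t) K K)
    (habs : ∀ X₁ ∈ D, ∃ t, MapsTo (τ t) (univ ×ˢ X₁) K) :
    ∃ A, IsGlobalAttractor τ D A := by
  have hc : ∀ t, Continuous (τ t) := fun t =>
    h.continuous.comp (Continuous.prodMk continuous_const continuous_id)
  refine ⟨omegaLimit atTop τ K, ?_, image_omegaLimit_eq_of_isCompact hc h.add hK hKK, ?_⟩
  · refine hK.of_isClosed_subset (isClosed_omegaLimit _ _ _) ?_
    rw [omegaLimit_eq_iInter]
    exact (iInter_subset _ ⟨_, hKK⟩).trans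
      (closure_minimal (by rintro _ ⟨t, ht, x, hx, rfl⟩; exact ht hx) hK.isClosed)
  · intro X₁ hX₁
    obtain ⟨t₁, ht₁⟩ := habs X₁ hX₁
    rw [ENNReal.tendsto_nhds_zero]
    intro ε hε
    obtain ⟨δ, hδ0, hδ⟩ : ∃ δ : ℝ, 0 < δ ∧ ENNReal.ofReal δ ≤ ε := by
      obtain ⟨δ, h0, h1⟩ := ENNReal.lt_iff_exists_nnreal_btwn.1 hε
      exact ⟨δ, by simpa using h0, by simpa using h1.le⟩
    obtain ⟨u, hu, hsub⟩ :=
      eventually_closure_subset_of_isCompact_absorbing_of_isOpen_of_omegaLimit_subset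
      atTop τ K hK hKK (Metric.isOpen_thickening (δ := δ) (E := omegaLimit atTop τ K))
      (Metric.self_subset_thickening hδ0 _)
    obtain ⟨t₀, ht₀⟩ := mem_atTop_sets.1 hu
    filter_upwards [eventually_ge_atTop (t₀ + t₁)] with t ht
    refine (hausdorffSemidist_le_of_subset_thickening ?_).trans hδ
    rintro _ ⟨p, hp, rfl⟩
    have : τ t p = τ (t - t₁) (τ t₁ p) := by
      rw [← h.add, tsub_add_cancel_of_le ((le_add_left le_rfl).trans ht)]
    rw [this]
    exact hsub (subset_closure (mem_image2_of_mem (ht₀ _ (le_tsub_of_add_le_right ht)) (ht₁ hp)))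

/-! ### Delay equations in `ℝᵐ` with one delay per component -/

section Delay

open BoundedContinuousFunction

variable {m : ℕ} {r : Fin m → ℝ}

/-- The delayed vector `(Yᵢ(t - rᵢ))ᵢ`. -/
def delayed (r : Fin m → ℝ) (Y : ℝ → Fin m → ℝ) (t : ℝ) : Fin m → ℝ := fun i => Y (t - r i) i

theorem continuous_delayed {Y : ℝ → Fin m → ℝ} (hY : Continuous Y) : Continuous (delayed r Y) := by
  unfold delayed
  fun_prop

theorem norm_delayed_le {Y : ℝ → Fin m → ℝ} {t C : ℝ} (hC : 0 ≤ C)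
    (h : ∀ i, ‖Y (t - r i)‖ ≤ C) : ‖delayed r Y t‖ ≤ C :=
  (pi_norm_le_iff_of_nonneg hC).2 fun i => (norm_le_pi_norm (Y (t - r i)) i).trans (h i)

/-- A Grönwall inequality with delays. It is proved by taking the maximum over `[0, T]` of the
weighted norm `exp (-4Lt) ‖w t‖`: the weight makes the contribution of the maximum to the
right-hand side at most half of it. -/
theorem norm_le_of_norm_deriv_le_delayed (hr : ∀ i, 0 ≤ r i) {w w' : ℝ → Fin m → ℝ}
    {L a b T : ℝ} (hL : 0 < L) (ha : 0 ≤ a) (hb : 0 ≤ b) (hw : Continuous w)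
    (hinit : ∀ t ≤ 0, ‖w t‖ ≤ a)
    (hderiv : ∀ t ∈ Ico 0 T, HasDerivWithinAt w (w' t) (Ici 0) t)
    (hbound : ∀ t ∈ Ico 0 T, ‖w' t‖ ≤ L * (‖w t‖ + ‖delayed r w t‖) + b) :
    ∀ t ∈ Icc 0 T, ‖w t‖ ≤ 3 * (a + b * T) * Real.exp (4 * L * t) := by
  intro t₁ ht₁
  have hT : 0 ≤ T := ht₁.1.trans ht₁.2
  obtain ⟨s, hs, hmax⟩ := (isCompact_Icc (a := (0 : ℝ)) (b := T)).exists_isMaxOn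
    ⟨0, left_mem_Icc.2 hT⟩ (f := fun t => Real.exp (-(4 * L * t)) * ‖w t‖) (by fun_prop)
  set N := Real.exp (-(4 * L * s)) * ‖w s‖ with hN
  have hN0 : 0 ≤ N := by positivity
  have hwN : ∀ t ∈ Icc 0 T, ‖w t‖ ≤ N * Real.exp (4 * L * t) := by
    intro t ht
    have h1 : Real.exp (-(4 * L * t)) * ‖w t‖ ≤ N := hmax ht
    rw [Real.exp_neg, inv_mul_le_iff₀ (Real.exp_pos _)] at h1
    linarith
  have hws : ‖w s‖ = N * Real.exp (4 * L * s) := by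
    rw [hN, mul_right_comm, ← Real.exp_add]; simp
  have hdel : ∀ t ∈ Ico 0 T, ‖delayed r w t‖ ≤ (N + a) * Real.exp (4 * L * t) := by
    intro t ht
    refine norm_delayed_le (by positivity) fun i => ?_
    rcases le_or_gt (t - r i) 0 with h | h
    · refine (hinit _ h).trans ?_
      have : 1 ≤ Real.exp (4 * L * t) := Real.one_le_exp (by have := ht.1; positivity)
      nlinarith
    · refine (hwN _ ⟨h.le, by linarith [hr i, ht.2]⟩).trans ?_
      have : Real.exp (4 * L * (t - r i)) ≤ Real.exp (4 * L * t) :=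
        Real.exp_le_exp.2 (by nlinarith [hr i])
      have h2 := Real.exp_pos (4 * L * t)
      nlinarith
  have key := image_norm_le_of_norm_deriv_right_le_deriv_boundary (f := w) (a := 0) (b := T)
    (f' := w') hw.continuousOn
    (fun t ht => (hderiv t ht).mono (Ici_subset_Ici.2 ht.1))
    (B := fun t => a + b * t + (2 * N + a) / 4 * (Real.exp (4 * L * t) - 1))
    (B' := fun t => b + (2 * N + a) * L * Real.exp (4 * L * t))
    (by simpa using hinit 0 le_rfl)
    (fun t => by
      have h1 : HasDerivAt (fun t : ℝ => 4 * L * t) (4 * L) t := by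
        simpa using (hasDerivAt_id t).const_mul (4 * L)
      have h2 : HasDerivAt (fun t : ℝ => b * t) b t := by
        simpa using (hasDerivAt_id t).const_mul b
      exact ((h2.const_add a).add ((h1.exp.sub_const 1).const_mul ((2 * N + a) / 4))).congr_deriv
        (by ring))
    (fun t ht => by
      have h1 := hbound t ht
      have h2 := hwN t ⟨ht.1, ht.2.le⟩
      have h3 := hdel t ht
      nlinarith)
  have h1 := key hs
  rw [hws] at h1
  have hX : 1 ≤ Real.exp (4 * L * s) := Real.one_le_exp (by have := hs.1; positivity)
  have hbs : b * s ≤ b * T := mul_le_mul_of_nonneg_left hs.2 hb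
  have hbT : 0 ≤ b * T := by positivity
  have hN3 : N ≤ 3 * (a + b * T) := by
    by_contra! hcon
    nlinarith
  exact (hwN _ ht₁).trans (mul_le_mul_of_nonneg_right hN3 (Real.exp_pos _).le)

theorem norm_integral_le_of_norm_le_exp {E : Type*} [NormedAddCommGroup E] [NormedSpace ℝ E]
    {g : ℝ → E} {C k τ : ℝ} (hk : 0 < k) (hτ : 0 ≤ τ) (hC : 0 ≤ C)
    (hg : ∀ s, 0 ≤ s → ‖g s‖ ≤ C * Real.exp (k * s)) :
    ‖∫ s in (0 : ℝ)..τ, g s‖ ≤ C / k * Real.exp (k * τ) := by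
  have h1 : ‖∫ s in (0 : ℝ)..τ, g s‖ ≤ ∫ s in (0 : ℝ)..τ, C * Real.exp (k * s) :=
    intervalIntegral.norm_integral_le_of_norm_le hτ
      (Eventually.of_forall fun s hs => hg s hs.1.le)
      (by apply Continuous.intervalIntegrable; fun_prop)
  refine h1.trans ?_
  rw [intervalIntegral.integral_const_mul,
    intervalIntegral.integral_comp_mul_left (f := Real.exp) hk.ne', integral_exp]
  have : 0 < k⁻¹ := inv_pos.2 hk
  simp only [mul_zero, Real.exp_zero, smul_eq_mul]
  rw [div_mul_eq_mul_div, mul_comm k⁻¹, ← mul_assoc, ← div_eq_mul_inv]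
  gcongr
  linarith

/-- Global existence for a delay equation with a globally Lipschitz right-hand side. The solution
is a fixed point of the integral operator, a contraction on the space of functions of growth at
most `exp (4Lt)`, written as `exp (4L max(t, 0)) • Z` with `Z` bounded and continuous. -/
theorem exists_delay_solution (hr : ∀ i, 0 ≤ r i)
    {F : ℝ → (Fin m → ℝ) → (Fin m → ℝ) → Fin m → ℝ}
    (hF : Continuous fun p : ℝ × (Fin m → ℝ) × (Fin m → ℝ) => F p.1 p.2.1 p.2.2)
    {L b : ℝ} (hL : 0 < L) (hb : 0 ≤ b)
    (hlip : ∀ t x z x' z', ‖F t x z - F t x' z'‖ ≤ L * (‖x - x'‖ + ‖z - z'‖))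
    (hF0 : ∀ t, ‖F t 0 0‖ ≤ b) (φ : ℝ →ᵇ (Fin m → ℝ)) :
    ∃ Y : ℝ → Fin m → ℝ, Continuous Y ∧ (∀ t ≤ 0, Y t = φ t) ∧
      ∀ t, 0 ≤ t → HasDerivWithinAt Y (F t (Y t) (delayed r Y t)) (Ici 0) t := by
  set k := 4 * L with hk
  have hk0 : 0 < k := by positivity
  let lift : (ℝ →ᵇ (Fin m → ℝ)) → ℝ → Fin m → ℝ := fun Z t => Real.exp (k * max t 0) • Z t
  have hlift : ∀ Z, Continuous (lift Z) := fun Z => by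
    have := Z.continuous
    fun_prop
  have hlift_sub : ∀ Z Z' : ℝ →ᵇ (Fin m → ℝ), lift (Z - Z') = lift Z - lift Z' := fun Z Z' => by
    ext t i; simp [lift, mul_sub]
  have hlift_norm : ∀ Z s t, s ≤ t → 0 ≤ t → ‖lift Z s‖ ≤ Real.exp (k * t) * ‖Z‖ := by
    intro Z s t hst ht
    rw [norm_smul, Real.norm_of_nonneg (Real.exp_pos _).le]
    have := max_le hst ht
    gcongr
    exact Z.norm_coe_le_norm s
  have hdel_norm : ∀ Z t, 0 ≤ t → ‖delayed r (lift Z) t‖ ≤ Real.exp (k * t) * ‖Z‖ :=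
    fun Z t ht => norm_delayed_le (by positivity) fun i =>
      hlift_norm Z _ t (by linarith [hr i]) ht
  let G : (ℝ →ᵇ (Fin m → ℝ)) → ℝ → Fin m → ℝ := fun Z s => F s (lift Z s) (delayed r (lift Z) s)
  have hG : ∀ Z, Continuous (G Z) := fun Z =>
    hF.comp (continuous_id.prodMk ((hlift Z).prodMk (continuous_delayed (hlift Z))))
  have hGsub : ∀ Z Z' s, 0 ≤ s → ‖G Z s - G Z' s‖ ≤ 2 * L * ‖Z - Z'‖ * Real.exp (k * s) := by
    intro Z Z' s hs
    have h1 := hlift_norm (Z - Z') s s le_rfl hs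
    have h2 := hdel_norm (Z - Z') s hs
    have h3 : delayed r (lift (Z - Z')) s = delayed r (lift Z) s - delayed r (lift Z') s := by
      rw [hlift_sub]; rfl
    rw [h3] at h2
    rw [hlift_sub, Pi.sub_apply] at h1
    refine (hlip _ _ _ _ _).trans ?_
    nlinarith
  have hGnorm : ∀ Z s, 0 ≤ s → ‖G Z s‖ ≤ (b + 2 * L * ‖Z‖) * Real.exp (k * s) := by
    intro Z s hs
    have h1 := hlift_norm Z s s le_rfl hs
    have h2 := hdel_norm Z s hs
    have h3 := hlip s (lift Z s) (delayed r (lift Z) s) 0 0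
    rw [sub_zero, sub_zero] at h3
    have h4 : ‖G Z s‖ ≤ ‖G Z s - F s 0 0‖ + ‖F s 0 0‖ := by
      simpa using norm_add_le (G Z s - F s 0 0) (F s 0 0)
    have h5 : 1 ≤ Real.exp (k * s) := Real.one_le_exp (by positivity)
    have h6 := hF0 s
    change ‖G Z s - F s 0 0‖ ≤ _ at h3
    nlinarith
  let J : (ℝ →ᵇ (Fin m → ℝ)) → ℝ → Fin m → ℝ := fun Z t =>
    φ (min t 0) + ∫ s in (0 : ℝ)..max t 0, G Z s
  have hprim : ∀ Z, Continuous fun u => ∫ s in (0 : ℝ)..u, G Z s := fun Z =>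
    intervalIntegral.continuous_primitive (fun a b => (hG Z).intervalIntegrable a b) 0
  have hJ : ∀ Z, Continuous (J Z) := fun Z => by
    have h1 := φ.continuous
    have h2 : Continuous fun t : ℝ => ∫ s in (0 : ℝ)..max t 0, G Z s :=
      (hprim Z).comp (continuous_id.max continuous_const)
    exact (h1.comp (continuous_id.min continuous_const)).add h2
  let P : (ℝ →ᵇ (Fin m → ℝ)) → (ℝ →ᵇ (Fin m → ℝ)) := fun Z =>
    BoundedContinuousFunction.ofNormedAddCommGroup (fun t => Real.exp (-(k * max t 0)) • J Z t)
      (by have := hJ Z; fun_prop) (‖φ‖ + (b + 2 * L * ‖Z‖) / k) (by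
        intro t
        have h0 : 0 ≤ max t 0 := le_max_right _ _
        have h1 := norm_integral_le_of_norm_le_exp hk0 h0 (by positivity) (hGnorm Z)
        have h2 : ‖J Z t‖ ≤ ‖φ‖ + (b + 2 * L * ‖Z‖) / k * Real.exp (k * max t 0) :=
          (norm_add_le _ _).trans (add_le_add (φ.norm_coe_le_norm _) h1)
        have h3 : 1 ≤ Real.exp (k * max t 0) := Real.one_le_exp (by positivity)
        rw [norm_smul, Real.norm_of_nonneg (Real.exp_pos _).le, Real.exp_neg,
          inv_mul_le_iff₀ (Real.exp_pos _)]
        nlinarith [norm_nonneg φ])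
  have hP : ContractingWith (1 / 2) P := by
    refine ⟨by rw [← NNReal.coe_lt_coe]; norm_num, LipschitzWith.of_dist_le_mul fun Z Z' => ?_⟩
    rw [dist_eq_norm, dist_eq_norm]
    refine (BoundedContinuousFunction.norm_le (by positivity)).2 fun t => ?_
    have h0 : 0 ≤ max t 0 := le_max_right _ _
    have h1 : (P Z - P Z') t
        = Real.exp (-(k * max t 0)) • ∫ s in (0 : ℝ)..max t 0, (G Z s - G Z' s) := by
      rw [intervalIntegral.integral_sub ((hG Z).intervalIntegrable _ _)
        ((hG Z').intervalIntegrable _ _), BoundedContinuousFunction.sub_apply]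
      change Real.exp (-(k * max t 0)) • J Z t - Real.exp (-(k * max t 0)) • J Z' t = _
      rw [← smul_sub, add_sub_add_left_eq_sub]
    have h2 := norm_integral_le_of_norm_le_exp hk0 h0 (by positivity) (hGsub Z Z')
    rw [h1, norm_smul, Real.norm_of_nonneg (Real.exp_pos _).le, Real.exp_neg,
      inv_mul_le_iff₀ (Real.exp_pos _)]
    refine h2.trans (le_of_eq ?_)
    rw [hk]
    push_cast
    field_simp
    ring
  have hfix : P (ContractingWith.fixedPoint P hP) = ContractingWith.fixedPoint P hP :=
    hP.fixedPoint_isFixedPt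
  set Z := ContractingWith.fixedPoint P hP
  have hY : ∀ t, lift Z t = J Z t := by
    intro t
    have h1 : Z t = Real.exp (-(k * max t 0)) • J Z t := (DFunLike.congr_fun hfix t).symm
    change Real.exp (k * max t 0) • Z t = _
    rw [h1, smul_smul, ← Real.exp_add, add_neg_cancel, Real.exp_zero, one_smul]
  refine ⟨lift Z, hlift Z, fun t ht => ?_, fun t ht => ?_⟩
  · rw [hY]
    simp [J, min_eq_left ht, max_eq_right ht]
  · have h1 : HasDerivAt (fun u => φ 0 + ∫ s in (0 : ℝ)..u, G Z s) (G Z t) t :=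
      (intervalIntegral.integral_hasDerivAt_right ((hG Z).intervalIntegrable _ _)
        ((hG Z).stronglyMeasurableAtFilter _ _) (hG Z).continuousAt).const_add _
    refine h1.hasDerivWithinAt.congr_of_mem (fun u hu => ?_) ht
    rw [hY]
    have hu' : (0 : ℝ) ≤ u := hu
    simp only [J, min_eq_right hu', max_eq_left hu']

/-- A function whose derivative is nonnegative wherever the function is negative stays
nonnegative. -/
theorem nonneg_of_deriv_nonneg_of_neg {f f' : ℝ → ℝ} (hf : Continuous f) (h0 : 0 ≤ f 0)
    (hd : ∀ t, 0 ≤ t → HasDerivWithinAt f (f' t) (Ici 0) t)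
    (h : ∀ t, 0 ≤ t → f t < 0 → 0 ≤ f' t) : ∀ t, 0 ≤ t → 0 ≤ f t := by
  intro t ht
  by_contra! hneg
  have h2 : 0 < 1 + t := by linarith
  -- compare `-f` with the line `ε (1 + t)` for a small slope `ε`
  set ε := -f t / (2 * (1 + t)) with hε
  have hε0 : 0 < ε := div_pos (by linarith) (by positivity)
  have key := image_le_of_deriv_right_lt_deriv_boundary' (f := fun u => -f u)
    (f' := fun u => -f' u) (a := 0) (b := t) hf.neg.continuousOn
    (fun u hu => ((hd u hu.1).mono (Ici_subset_Ici.2 hu.1)).neg)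
    (B := fun u => ε * (1 + u)) (B' := fun _ => ε) (by simp only [add_zero, mul_one]; linarith)
    (by fun_prop)
    (fun u hu => by
      simpa using (((hasDerivAt_id u).const_add 1).const_mul ε).hasDerivWithinAt (s := Ici u))
    (fun u hu he => by
      have h3 : 0 < ε * (1 + u) := mul_pos hε0 (by linarith [hu.1])
      have := h u hu.1 (by linarith)
      linarith) (right_mem_Icc.2 ht)
  have h3 : ε * (1 + t) = -f t / 2 := by rw [hε]; field_simp
  simp only [h3] at key
  linarith

/-- The mean value inequality for one-sided derivatives. -/
theorem le_add_mul_of_deriv_le {f f' : ℝ → ℝ} {C a b : ℝ} (hf : Continuous f) (ha : 0 ≤ a)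
    (hd : ∀ t, 0 ≤ t → HasDerivWithinAt f (f' t) (Ici 0) t) (h : ∀ t ∈ Icc a b, f' t ≤ C) :
    ∀ t ∈ Icc a b, f t ≤ f a + C * (t - a) := by
  intro t ht
  refine image_le_of_deriv_right_le_deriv_boundary (f := f) (f' := f') hf.continuousOn
    (fun u hu => (hd u (ha.trans hu.1)).mono (Ici_subset_Ici.2 (ha.trans hu.1)))
    (B := fun u => f a + C * (u - a)) (B' := fun _ => C) (by simp) (by fun_prop)
    (fun u hu => ?_) (fun u hu => h u ⟨hu.1, hu.2.le⟩) ht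
  simpa using ((((hasDerivAt_id u).sub_const a).const_mul C).const_add (f a)).hasDerivWithinAt
    (s := Ici u)

end Delay

/-! ### Almost periodic functions and compactness of the hull -/

section AlmostPeriodic

theorem IsAlmostPeriodic.uniformContinuous {h : ℝ → ℝ} (hh : IsAlmostPeriodic h) :
    UniformContinuous h := by
  rw [Metric.uniformContinuous_iff]
  intro ε hε
  obtain ⟨L, hL, hP⟩ := hh.2 (ε / 3) (by positivity)
  obtain ⟨δ, hδ, hδ'⟩ := Metric.uniformContinuousOn_iff.1
    ((isCompact_Icc (a := (-1 : ℝ)) (b := L + 1)).uniformContinuousOn_of_continuous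
      hh.1.continuousOn) (ε / 3) (by positivity)
  refine ⟨min δ 1, by positivity, fun {x y} hxy => ?_⟩
  obtain ⟨s, hs, h1, h2⟩ := hP (-x)
  have hxy1 : |x - y| < 1 := hxy.trans_le (min_le_right _ _)
  rw [abs_lt] at hxy1
  have h3 := hδ' (x + s) ⟨by linarith, by linarith⟩ (y + s) ⟨by linarith, by linarith⟩
    (by rw [dist_add_right]; exact hxy.trans_le (min_le_left _ _))
  have h4 := hs x
  have h5 := hs y
  rw [Real.dist_eq] at h3 ⊢
  rw [abs_lt] at *
  constructor <;> linarith

/-- For every `ε`, the reals can be partitioned into finitely many classes such that the translates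
of `f` by two reals of the same class are uniformly `ε`-close. This total boundedness of the set of
translates (Bochner's criterion) is, unlike the relative density of the almost periods, visibly
stable under finite products. -/
def HasPrecompactTranslates {E : Type*} [PseudoMetricSpace E] (f : ℝ → E) : Prop :=
  ∀ ε : ℝ, 0 < ε → ∃ (ι : Type) (_ : Finite ι) (κ : ℝ → ι),
    ∀ t t', κ t = κ t' → ∀ u, dist (f (t + u)) (f (t' + u)) < ε

theorem IsAlmostPeriodic.hasPrecompactTranslates {h : ℝ → ℝ} (hh : IsAlmostPeriodic h) :
    HasPrecompactTranslates h := by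
  intro ε hε
  obtain ⟨L, hL, hP⟩ := hh.2 (ε / 4) (by positivity)
  obtain ⟨δ, hδ, hδ'⟩ := Metric.uniformContinuous_iff.1 hh.uniformContinuous (ε / 4) (by positivity)
  obtain ⟨F, hF, hcov⟩ := Metric.totallyBounded_iff.1
    (isCompact_Icc (a := (0 : ℝ)) (b := L)).totallyBounded δ hδ
  have hex : ∀ t : ℝ, ∃ c : F, ∀ u, dist (h (t + u)) (h (c + u)) < ε / 2 := by
    intro t
    obtain ⟨s, hs, h1, h2⟩ := hP (-t)
    obtain ⟨c, hc, hsc⟩ := mem_iUnion₂.1 (hcov (a := t + s) ⟨by linarith, by linarith⟩)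
    refine ⟨⟨c, hc⟩, fun u => ?_⟩
    have h3 := hs (t + u)
    have h4 := hδ' (a := t + s + u) (b := c + u) (by rw [dist_add_right]; exact hsc)
    rw [show t + u + s = t + s + u by ring] at h3
    rw [Real.dist_eq] at h4 ⊢
    rw [abs_lt] at *
    constructor <;> linarith
  choose κ hκ using hex
  refine ⟨F, hF, κ, fun t t' htt u => ?_⟩
  have h1 := hκ t u
  have h2 := hκ t' u
  rw [← htt] at h2
  have := dist_triangle_right (h (t + u)) (h (t' + u)) (h (κ t + u))
  linarith

theorem HasPrecompactTranslates.pi {n : ℕ} {E : Fin n → Type*} [∀ i, PseudoMetricSpace (E i)]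
    {f : ∀ i, ℝ → E i} (hf : ∀ i, HasPrecompactTranslates (f i)) :
    HasPrecompactTranslates fun t i => f i t := by
  intro ε hε
  choose ι hι κ hκ using fun i => hf i ε hε
  exact ⟨∀ i, ι i, inferInstance, fun t i => κ i t, fun t t' h u =>
    (dist_pi_lt_iff hε).2 fun i => hκ i t t' (congrFun h i) u⟩

theorem HasPrecompactTranslates.prodMk {E E' : Type*} [PseudoMetricSpace E] [PseudoMetricSpace E']
    {f : ℝ → E} {g : ℝ → E'} (hf : HasPrecompactTranslates f) (hg : HasPrecompactTranslates g) :
    HasPrecompactTranslates fun t => (f t, g t) := by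
  intro ε hε
  obtain ⟨ι, hι, κ, hκ⟩ := hf ε hε
  obtain ⟨ι', hι', κ', hκ'⟩ := hg ε hε
  exact ⟨ι × ι', inferInstance, fun t => (κ t, κ' t), fun t t' h u =>
    max_lt (hκ t t' (congrArg Prod.fst h) u) (hκ' t t' (congrArg Prod.snd h) u)⟩

/-- Choosing a representative of each of the finitely many classes, a translate is brought back
near a representative, within a bounded time. -/
theorem HasPrecompactTranslates.relativelyDense {E : Type*} [PseudoMetricSpace E] {f : ℝ → E}
    (hf : HasPrecompactTranslates f) {ε : ℝ} (hε : 0 < ε) :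
    RelativelyDense {s : ℝ | ∀ t, dist (f (t + s)) (f t) < ε} := by
  obtain ⟨ι, hι, κ, hκ⟩ := hf ε hε
  choose rep hrep using fun c : range κ => c.2
  obtain ⟨M, hM⟩ : ∃ M : ℝ, ∀ c, |rep c| ≤ M := by
    obtain ⟨M, hM⟩ := (finite_range fun c => |rep c|).bddAbove
    exact ⟨M, fun c => hM (mem_range_self c)⟩
  have hM0 : 0 ≤ M := (abs_nonneg _).trans (hM ⟨κ 0, 0, rfl⟩)
  refine ⟨2 * M + 1, by linarith, fun a => ?_⟩
  set c : range κ := ⟨κ (a + M), a + M, rfl⟩ with hc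
  have h1 := abs_le.1 (hM c)
  refine ⟨a + M - rep c, fun t => ?_, by linarith, by linarith⟩
  have := hκ (a + M) (rep c) (hrep c).symm (t - rep c)
  convert this using 3 <;> ring

end AlmostPeriodic

namespace NicholsonSystem

variable {m : ℕ} {S : NicholsonSystem m}

theorem Assumptions.hasPrecompactTranslates (hS : S.Assumptions) :
    HasPrecompactTranslates S.coeffMap :=
  (HasPrecompactTranslates.pi fun i => (hS.almostPeriodic_d i).hasPrecompactTranslates).prodMk
    ((HasPrecompactTranslates.pi fun i => HasPrecompactTranslates.pi fun j =>
      (hS.almostPeriodic_a i j).hasPrecompactTranslates).prodMk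
    ((HasPrecompactTranslates.pi fun i => (hS.almostPeriodic_β i).hasPrecompactTranslates).prodMk
    (HasPrecompactTranslates.pi fun i => (hS.almostPeriodic_c i).hasPrecompactTranslates)))

theorem Assumptions.uniformContinuous (hS : S.Assumptions) : UniformContinuous S.coeffMap :=
  (uniformContinuous_pi.2 fun i => (hS.almostPeriodic_d i).uniformContinuous).prodMk
    ((uniformContinuous_pi.2 fun i => uniformContinuous_pi.2 fun j =>
      (hS.almostPeriodic_a i j).uniformContinuous).prodMk
    ((uniformContinuous_pi.2 fun i => (hS.almostPeriodic_β i).uniformContinuous).prodMk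
    (uniformContinuous_pi.2 fun i => (hS.almostPeriodic_c i).uniformContinuous)))

theorem translate_coeffMap_mem_hullSet (t : ℝ) : translate t S.coeffMap ∈ S.hullSet :=
  subset_closure ⟨t, rfl⟩

theorem Assumptions.isCompact_hullSet (hS : S.Assumptions) : IsCompact S.hullSet := by
  refine TotallyBounded.isCompact_of_isClosed (TotallyBounded.closure ?_) isClosed_closure
  rw [ContinuousMap.hasBasis_compactConvergenceUniformity.totallyBounded_iff]
  rintro ⟨K, V⟩ ⟨-, hV⟩
  obtain ⟨ε, hε, hεV⟩ := Metric.mem_uniformity_dist.1 hV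
  obtain ⟨ι, hι, κ, hκ⟩ := hS.hasPrecompactTranslates ε hε
  choose rep hrep using fun c : range κ => c.2
  refine ⟨range fun c => translate (rep c) S.coeffMap, finite_range _, ?_⟩
  rintro _ ⟨t, rfl⟩
  refine mem_iUnion₂.2 ⟨_, ⟨⟨κ t, t, rfl⟩, rfl⟩, fun u _ => hεV ?_⟩
  exact hκ t (rep ⟨κ t, t, rfl⟩) (hrep ⟨κ t, t, rfl⟩).symm u

/-- A closed property of functions shared by all translates of the coefficient map passes to the
hull. -/
theorem mem_of_forall_translate_mem {C : Set C(ℝ, NicholsonCoeff m)} (hC : IsClosed C)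
    (h : ∀ t, translate t S.coeffMap ∈ C) (ω : S.Hull) : ω.1 ∈ C :=
  closure_minimal (by rintro _ ⟨t, rfl⟩; exact h t) hC ω.2

theorem shift_apply (t s : ℝ) (ω : S.Hull) : (S.shift t ω).1 s = ω.1 (t + s) := rfl

theorem shift_shift (t s : ℝ) (ω : S.Hull) : S.shift t (S.shift s ω) = S.shift (s + t) ω :=
  Subtype.ext (translate_translate t s ω.1)

theorem continuous_eval_hull : Continuous fun p : S.Hull × ℝ => p.1.1 p.2 := by
  have : Continuous fun ω : S.Hull => ω.1 := continuous_subtype_val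
  fun_prop

theorem isContinuousFlow_shift (S : NicholsonSystem m) : IsContinuousFlow S.shift where
  continuous := by
    refine Continuous.subtype_mk (ContinuousMap.continuous_of_continuous_uncurry _ ?_) _
    exact continuous_eval_hull.comp (f := fun q : (ℝ × S.Hull) × ℝ => (q.1.2, q.1.1 + q.2))
      (by fun_prop)
  zero ω := Subtype.ext (ContinuousMap.ext fun s => by
    change ω.1 (0 + s) = ω.1 s
    rw [zero_add])
  add t s ω := by rw [shift_shift, add_comm]

end NicholsonSystem

/-! ### The Nicholson vector field and bounds on the hull -/

namespace NicholsonSystem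

variable {m : ℕ} {S : NicholsonSystem m}

/-- The Nicholson vector field with coefficients `p = (d, a, β, c)`, with separate arguments for
the three occurrences of the unknown: in the decay term, in the coupling term and in the delayed
term. -/
noncomputable def vectorField (p : NicholsonCoeff m) (x v z : Fin m → ℝ) : Fin m → ℝ := fun i =>
  -p.1 i * x i + ∑ j, p.2.1 i j * v j + p.2.2.1 i * z i * Real.exp (-p.2.2.2 i * z i)

theorem continuous_vectorField : Continuous fun q : NicholsonCoeff m × (Fin m → ℝ) ×
    (Fin m → ℝ) × (Fin m → ℝ) => vectorField q.1 q.2.1 q.2.2.1 q.2.2.2 := by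
  unfold vectorField
  fun_prop

/-- The bounds on the coefficients that hold uniformly on the hull. The strict inequalities
`β > 0` and `d - ∑ a > 0` become weak ones in the closure. -/
structure CoeffBounds (M c₀ : ℝ) (p : NicholsonCoeff m) : Prop where
  norm_le : ‖p‖ ≤ M
  d_nonneg : ∀ i, 0 ≤ p.1 i
  a_nonneg : ∀ i j, 0 ≤ p.2.1 i j
  β_nonneg : ∀ i, 0 ≤ p.2.2.1 i
  c_ge : ∀ i, c₀ ≤ p.2.2.2 i
  dominance : ∀ i, ∑ j, p.2.1 j i ≤ p.1 i

namespace CoeffBounds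

variable {M c₀ : ℝ} {p : NicholsonCoeff m}

theorem d_le (h : CoeffBounds M c₀ p) (i : Fin m) : |p.1 i| ≤ M :=
  (norm_le_pi_norm p.1 i).trans ((norm_fst_le p).trans h.norm_le)

theorem a_le (h : CoeffBounds M c₀ p) (i j : Fin m) : |p.2.1 i j| ≤ M :=
  (norm_le_pi_norm (p.2.1 i) j).trans ((norm_le_pi_norm p.2.1 i).trans
    ((norm_fst_le p.2).trans ((norm_snd_le p).trans h.norm_le)))

theorem β_le (h : CoeffBounds M c₀ p) (i : Fin m) : |p.2.2.1 i| ≤ M :=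
  (norm_le_pi_norm p.2.2.1 i).trans ((norm_fst_le p.2.2).trans
    ((norm_snd_le p.2).trans ((norm_snd_le p).trans h.norm_le)))

theorem c_le (h : CoeffBounds M c₀ p) (i : Fin m) : |p.2.2.2 i| ≤ M :=
  (norm_le_pi_norm p.2.2.2 i).trans ((norm_snd_le p.2.2).trans
    ((norm_snd_le p.2).trans ((norm_snd_le p).trans h.norm_le)))

end CoeffBounds

theorem isClosed_coeffBounds (M c₀ : ℝ) : IsClosed {p : NicholsonCoeff m | CoeffBounds M c₀ p} := by
  have : {p : NicholsonCoeff m | CoeffBounds M c₀ p} = {p | ‖p‖ ≤ M ∧ (∀ i, 0 ≤ p.1 i) ∧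
      (∀ i j, 0 ≤ p.2.1 i j) ∧ (∀ i, 0 ≤ p.2.2.1 i) ∧ (∀ i, c₀ ≤ p.2.2.2 i) ∧
      ∀ i, ∑ j, p.2.1 j i ≤ p.1 i} :=
    Set.ext fun p => ⟨fun ⟨h1, h2, h3, h4, h5, h6⟩ => ⟨h1, h2, h3, h4, h5, h6⟩,
      fun ⟨h1, h2, h3, h4, h5, h6⟩ => ⟨h1, h2, h3, h4, h5, h6⟩⟩
  rw [this]
  simp only [ofPred_and, ofPred_forall]
  refine .inter ?_ (.inter ?_ (.inter ?_ (.inter ?_ (.inter ?_ ?_))))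
  · exact isClosed_le (by fun_prop) (by fun_prop)
  · exact isClosed_iInter fun i => isClosed_le (by fun_prop) (by fun_prop)
  · exact isClosed_iInter fun i => isClosed_iInter fun j => isClosed_le (by fun_prop) (by fun_prop)
  · exact isClosed_iInter fun i => isClosed_le (by fun_prop) (by fun_prop)
  · exact isClosed_iInter fun i => isClosed_le (by fun_prop) (by fun_prop)
  · exact isClosed_iInter fun i => isClosed_le (by fun_prop) (by fun_prop)

theorem Assumptions.exists_coeffBounds (hS : S.Assumptions) :
    ∃ M c₀ : ℝ, 0 < M ∧ 0 < c₀ ∧ ∀ (ω : S.Hull) (t : ℝ), CoeffBounds M c₀ (ω.1 t) := by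
  obtain ⟨c₀, hc₀, hc⟩ := hS.c_lower
  obtain ⟨d₀, hd₀, hd⟩ := hS.d_lower
  have hev : Continuous fun f : C(ℝ, NicholsonCoeff m) => f 0 := by fun_prop
  obtain ⟨M, hM0, hM⟩ := (hS.isCompact_hullSet.image hev).isBounded.exists_pos_norm_le
  refine ⟨M, c₀, hM0, hc₀, fun ω t => ?_⟩
  refine mem_of_forall_translate_mem (C := {f | CoeffBounds M c₀ (f t)})
    ((isClosed_coeffBounds M c₀).preimage (by fun_prop)) (fun s => ?_) ω
  refine ⟨?_, fun i => hd₀.le.trans (hd i _), fun i j => hS.a_nonneg i j _,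
    fun i => (hS.β_pos i _).le, fun i => hc i _, fun i => by
      have := hS.dominance i (s + t)
      change ∑ j, S.a j i (s + t) ≤ S.d i (s + t)
      linarith⟩
  refine hM _ ⟨translate (s + t) S.coeffMap, translate_coeffMap_mem_hullSet _, ?_⟩
  change S.coeffMap (s + t + 0) = S.coeffMap (s + t)
  rw [add_zero]

/-- The Ricker function `z ↦ z exp (-cz)` is Lipschitz on `[-R, ∞)`; for `R = 0` the constant
is `1`. -/
theorem abs_ricker_sub_le {c M R z z' : ℝ} (hc : 0 ≤ c) (hcM : c ≤ M) (hR : 0 ≤ R)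
    (hz : -R ≤ z) (hz' : -R ≤ z') :
    |z * Real.exp (-c * z) - z' * Real.exp (-c * z')|
      ≤ (1 + M * R) * Real.exp (M * R) * |z - z'| := by
  have hder : ∀ u ∈ Ici (-R), HasDerivWithinAt (fun u => u * Real.exp (-c * u))
      ((1 - c * u) * Real.exp (-c * u)) (Ici (-R)) u := by
    intro u _
    have h1 : HasDerivAt (fun u : ℝ => -c * u) (-c) u := by
      simpa using (hasDerivAt_id u).const_mul (-c)
    exact ((hasDerivAt_id u).mul h1.exp |>.congr_deriv (by simp; ring)).hasDerivWithinAt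
  refine Convex.norm_image_sub_le_of_norm_hasDerivWithin_le hder (fun u hu => ?_)
    (convex_Ici _) hz' hz
  have hu' : -R ≤ u := hu
  have hMR : 0 ≤ M * R := mul_nonneg (hc.trans hcM) hR
  rw [norm_mul, Real.norm_of_nonneg (Real.exp_pos _).le, Real.norm_eq_abs]
  rcases le_or_gt 0 u with h0 | h0
  · have hcu : 0 ≤ c * u := mul_nonneg hc h0
    have h1 : |1 - c * u| ≤ Real.exp (c * u) :=
      (abs_le.2 ⟨by linarith, by linarith⟩ : |1 - c * u| ≤ c * u + 1).trans
        (Real.add_one_le_exp _)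
    calc |1 - c * u| * Real.exp (-c * u) ≤ Real.exp (c * u) * Real.exp (-c * u) := by gcongr
      _ = 1 := by rw [← Real.exp_add]; simp
      _ ≤ (1 + M * R) * Real.exp (M * R) := by
        have := Real.one_le_exp hMR
        nlinarith
  · have h2 : -c * u ≤ M * R := by nlinarith
    have h3 : |1 - c * u| ≤ 1 + M * R := by
      have : 0 ≤ -c * u := by nlinarith
      rw [abs_of_nonneg (by linarith)]
      linarith
    gcongr

/-- The Lipschitz constant of the vector field when the delayed argument is at least `-R`. -/
noncomputable def lipConst (m : ℕ) (M R : ℝ) : ℝ :=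
  M + m * M + M * ((1 + M * R) * Real.exp (M * R))

theorem lipConst_pos {M R : ℝ} (hM : 0 < M) (hR : 0 ≤ R) : 0 < lipConst m M R := by
  unfold lipConst
  positivity

theorem norm_vectorField_sub_le {M c₀ R : ℝ} (hM : 0 < M) (hc₀ : 0 < c₀) (hR : 0 ≤ R)
    {p : NicholsonCoeff m} (hp : CoeffBounds M c₀ p) {x v z x' v' z' : Fin m → ℝ}
    (hv : ‖v - v'‖ ≤ ‖x - x'‖) (hz : ∀ i, -R ≤ z i) (hz' : ∀ i, -R ≤ z' i) :
    ‖vectorField p x v z - vectorField p x' v' z'‖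
      ≤ lipConst m M R * (‖x - x'‖ + ‖z - z'‖) := by
  have hL := lipConst_pos (m := m) hM hR
  refine (pi_norm_le_iff_of_nonneg (by positivity)).2 fun i => ?_
  have h1 : |p.1 i * (x i - x' i)| ≤ M * ‖x - x'‖ := by
    rw [abs_mul]
    exact mul_le_mul (hp.d_le i) (norm_le_pi_norm (x - x') i) (abs_nonneg _) hM.le
  have h2 : |∑ j, p.2.1 i j * (v j - v' j)| ≤ m * M * ‖x - x'‖ := by
    refine (Finset.abs_sum_le_sum_abs _ _).trans ?_
    refine (Finset.sum_le_card_nsmul _ _ (M * ‖x - x'‖) fun j _ => ?_).trans (by simp [mul_assoc])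
    rw [abs_mul]
    exact mul_le_mul (hp.a_le i j) ((norm_le_pi_norm (v - v') j).trans hv) (abs_nonneg _) hM.le
  have h3 : |p.2.2.1 i * (z i * Real.exp (-p.2.2.2 i * z i)
      - z' i * Real.exp (-p.2.2.2 i * z' i))|
      ≤ M * ((1 + M * R) * Real.exp (M * R)) * ‖z - z'‖ := by
    rw [abs_mul, mul_assoc]
    refine mul_le_mul (hp.β_le i) ?_ (abs_nonneg _) hM.le
    refine (abs_ricker_sub_le (hc₀.le.trans (hp.c_ge i)) (le_of_abs_le (hp.c_le i)) hR
      (hz i) (hz' i)).trans ?_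
    gcongr
    exact norm_le_pi_norm (z - z') i
  have h4 : (vectorField p x v z - vectorField p x' v' z') i = -(p.1 i * (x i - x' i))
      + ∑ j, p.2.1 i j * (v j - v' j) + p.2.2.1 i * (z i * Real.exp (-p.2.2.2 i * z i)
      - z' i * Real.exp (-p.2.2.2 i * z' i)) := by
    simp only [vectorField, Pi.sub_apply, mul_sub, Finset.sum_sub_distrib]
    ring
  rw [h4, Real.norm_eq_abs]
  refine (abs_add_three _ _ _).trans ?_
  rw [abs_neg]
  have h5 : 0 ≤ M * ((1 + M * R) * Real.exp (M * R)) * ‖x - x'‖ := by positivity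
  have h6 : 0 ≤ M * ‖z - z'‖ := by positivity
  have h7 : 0 ≤ m * M * ‖z - z'‖ := by positivity
  unfold lipConst
  linarith

/-! ### Solutions: existence, uniqueness, positivity -/

/-- The continuous extension of an initial function to `ℝ`, constant outside `[-rᵢ, 0]`. -/
noncomputable def history (S : NicholsonSystem m) (φ : S.StateSpace) (t : ℝ) : Fin m → ℝ :=
  fun i => φ i (projIcc (-S.r i) 0 (by linarith [S.r_pos i]) t)

theorem continuous_history (φ : S.StateSpace) : Continuous (S.history φ) :=
  continuous_pi fun i => (φ i).continuous.comp continuous_projIcc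

theorem norm_history_sub_le (φ ψ : S.StateSpace) (t : ℝ) :
    ‖S.history φ t - S.history ψ t‖ ≤ dist φ ψ := by
  refine (pi_norm_le_iff_of_nonneg dist_nonneg).2 fun i => ?_
  rw [Pi.sub_apply, ← dist_eq_norm]
  exact (ContinuousMap.dist_apply_le_dist _).trans (dist_le_pi_dist φ ψ i)

theorem norm_history_le (φ : S.StateSpace) (t : ℝ) : ‖S.history φ t‖ ≤ ‖φ‖ := by
  have h : S.history 0 t = 0 := rfl
  simpa [h] using norm_history_sub_le φ 0 t

/-- A nonnegative solution, extended to all of `ℝ` and collected into one vector-valued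
function. -/
structure IsPosSolution (ω : S.Hull) (φ : S.PosCone) (Y : ℝ → Fin m → ℝ) : Prop where
  continuous : Continuous Y
  initial : ∀ t ≤ 0, Y t = S.history φ.1 t
  nonneg : ∀ t i, 0 ≤ Y t i
  deriv : ∀ t, 0 ≤ t →
    HasDerivWithinAt Y (vectorField (ω.1 t) (Y t) (Y t) (delayed S.r Y t)) (Ici 0) t

theorem continuous_sup_zero : Continuous fun x : Fin m → ℝ => x ⊔ 0 :=
  continuous_pi fun i => (continuous_apply i).max continuous_const

theorem norm_sup_zero_sub_le (x x' : Fin m → ℝ) : ‖x ⊔ 0 - x' ⊔ 0‖ ≤ ‖x - x'‖ := by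
  refine (pi_norm_le_iff_of_nonneg (norm_nonneg _)).2 fun i => ?_
  refine le_trans ?_ (norm_le_pi_norm (x - x') i)
  exact abs_max_sub_max_le_abs (x i) (x' i) 0

/-- Replacing the unknown by its positive part in the coupling and delayed terms makes the vector
field globally Lipschitz. Solutions of the truncated system stay nonnegative, as `-dᵢ yᵢ` is the
only term of `yᵢ'` that may be negative, so they solve the original system. -/
theorem exists_isPosSolution (hS : S.Assumptions) (ω : S.Hull) (φ : S.PosCone) :
    ∃ Y, IsPosSolution ω φ Y := by
  obtain ⟨M, c₀, hM, hc₀, hB⟩ := hS.exists_coeffBounds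
  obtain ⟨Y, hY, hinit, hder⟩ := exists_delay_solution (r := S.r) (fun i => (S.r_pos i).le)
    (F := fun t x z => vectorField (ω.1 t) x (x ⊔ 0) (z ⊔ 0))
    (by
      refine continuous_vectorField.comp (f := fun p : ℝ × (Fin m → ℝ) × (Fin m → ℝ) =>
        (ω.1 p.1, p.2.1, p.2.1 ⊔ 0, p.2.2 ⊔ 0)) ?_
      have := ω.1.continuous
      exact (this.comp continuous_fst).prodMk (continuous_snd.fst.prodMk
        ((continuous_sup_zero.comp continuous_snd.fst).prodMk
          (continuous_sup_zero.comp continuous_snd.snd))))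
    (lipConst_pos hM le_rfl) (b := 0) le_rfl
    (fun t x z x' z' => by
      refine (norm_vectorField_sub_le hM hc₀ le_rfl (hB ω t) (norm_sup_zero_sub_le x x')
        (by simp) (by simp)).trans ?_
      have := norm_sup_zero_sub_le z z'
      have := lipConst_pos (m := m) hM (le_refl 0)
      gcongr)
    (fun t => by
      have : vectorField (ω.1 t) 0 (0 ⊔ 0) (0 ⊔ 0) = 0 := by
        ext i
        simp [vectorField]
      rw [this, norm_zero])
    (BoundedContinuousFunction.ofNormedAddCommGroup (S.history φ.1) (continuous_history _) ‖φ.1‖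
      (norm_history_le _))
  have hpos : ∀ t i, 0 ≤ Y t i := by
    intro t i
    have hneg : ∀ t ≤ 0, 0 ≤ Y t i := fun t ht => by
      rw [hinit t ht]
      exact φ.2 i _
    rcases le_total t 0 with ht | ht
    · exact hneg t ht
    · refine nonneg_of_deriv_nonneg_of_neg (f := fun t => Y t i) (by fun_prop) (hneg 0 le_rfl)
        (fun t ht => (hasDerivWithinAt_pi.1 (hder t ht)) i) (fun t _ hlt => ?_) t ht
      have h1 : 0 ≤ -(ω.1 t).1 i * Y t i := by
        have := (hB ω t).d_nonneg i
        nlinarith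
      have h2 : 0 ≤ ∑ j, (ω.1 t).2.1 i j * (Y t ⊔ 0) j :=
        Finset.sum_nonneg fun j _ => mul_nonneg ((hB ω t).a_nonneg i j) (le_max_right _ _)
      have h3 : 0 ≤ (delayed S.r Y t ⊔ 0) i := le_max_right _ _
      have h4 := (hB ω t).β_nonneg i
      exact add_nonneg (add_nonneg h1 h2) (by positivity)
  refine ⟨Y, hY, hinit, hpos, fun t ht => ?_⟩
  have h1 : Y t ⊔ 0 = Y t := sup_eq_left.2 (hpos t)
  have h2 : delayed S.r Y t ⊔ 0 = delayed S.r Y t := sup_eq_left.2 fun i => hpos _ i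
  have h3 := hder t ht
  rwa [h1, h2] at h3

theorem IsPosSolution.isSolution {ω : S.Hull} {φ : S.PosCone} {Y : ℝ → Fin m → ℝ}
    (h : IsPosSolution ω φ Y) : S.IsSolution ω φ.1 fun i t => Y t i where
  continuousOn i := (continuous_pi_iff.1 h.continuous i).continuousOn
  initial i s := by
    rw [h.initial s s.2.2, history, projIcc_val]
  deriv i t ht := by
    simp only [hullD, hullA, hullB, hullC, shift_apply, add_zero]
    exact (hasDerivWithinAt_pi.1 (h.deriv t ht)) i

/-- Uniqueness: no sign is assumed on `y`, but on a bounded time interval the delayed values are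
bounded below, and the vector field is Lipschitz there. -/
theorem IsSolution.eq_of_isPosSolution (hS : S.Assumptions) {ω : S.Hull} {φ : S.PosCone}
    {y : Fin m → ℝ → ℝ} {Y : ℝ → Fin m → ℝ} (hy : S.IsSolution ω φ.1 y)
    (hY : IsPosSolution ω φ Y) (i : Fin m) {t : ℝ} (ht : -S.r i ≤ t) : y i t = Y t i := by
  obtain ⟨M, c₀, hM, hc₀, hB⟩ := hS.exists_coeffBounds
  let y' : ℝ → Fin m → ℝ := fun t i => y i (max t (-S.r i))
  have hy'c : Continuous y' := continuous_pi fun i =>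
    (hy.continuousOn i).comp_continuous (by fun_prop)
      fun t => mem_Ici.2 (le_max_right _ _)
  have hy'eq : ∀ i t, -S.r i ≤ t → y' t i = y i t := fun i t ht => by
    simp only [y', max_eq_left ht]
  have hr0 : ∀ i, -S.r i ≤ 0 := fun i => by linarith [S.r_pos i]
  have hy'd : ∀ t, 0 ≤ t → HasDerivWithinAt y'
      (vectorField (ω.1 t) (y' t) (y' t) (delayed S.r y' t)) (Ici 0) t := by
    intro t ht
    rw [hasDerivWithinAt_pi]
    intro i
    refine ((hy.deriv i t ht).congr_of_mem
      (fun u hu => hy'eq i u ((hr0 i).trans hu)) ht).congr_deriv ?_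
    have h1 : ∀ j, y' t j = y j t := fun j => hy'eq j t ((hr0 j).trans ht)
    have h2 : delayed S.r y' t i = y i (t - S.r i) := hy'eq i _ (by linarith)
    simp only [vectorField, h1, h2, hullD, hullA, hullB, hullC, shift_apply, add_zero]
  have hinit : ∀ t ≤ 0, y' t = Y t := by
    intro t ht
    ext i
    have h0 : max t (-S.r i) ∈ Icc (-S.r i) 0 := ⟨le_max_right _ _, max_le ht (hr0 i)⟩
    have h1 := hy.initial i ⟨_, h0⟩
    rw [hY.initial t ht]
    change y i (max t (-S.r i)) = _
    refine h1.trans ?_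
    rw [history]
    congr 1
    refine Subtype.ext ?_
    rw [coe_projIcc, min_eq_right ht]
    exact max_comm _ _
  rw [← hy'eq i t ht]
  rcases le_total t 0 with ht0 | ht0
  · rw [hinit t ht0]
  obtain ⟨R, hR0, hR⟩ := ((isCompact_Icc (a := (0 : ℝ)) (b := t)).image
    (continuous_delayed (r := S.r) hy'c)).isBounded.exists_pos_norm_le
  have key := norm_le_of_norm_deriv_le_delayed (r := S.r) (fun i => (S.r_pos i).le)
    (w := fun t => y' t - Y t) (T := t) (lipConst_pos (m := m) hM hR0.le) le_rfl le_rfl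
    (hy'c.sub hY.continuous) (fun s hs => by rw [hinit s hs, sub_self, norm_zero])
    (fun s hs => (hy'd s hs.1).sub (hY.deriv s hs.1))
    (fun s hs => by
      rw [add_zero]
      refine norm_vectorField_sub_le hM hc₀ hR0.le (hB ω s) le_rfl (fun i => ?_) (fun i => ?_)
      · have h1 := hR _ (mem_image_of_mem (delayed S.r y') ⟨hs.1, hs.2.le⟩)
        exact (abs_le.1 ((norm_le_pi_norm _ i).trans h1)).1
      · exact (neg_nonpos.2 hR0.le).trans (hY.nonneg _ _))
    t (right_mem_Icc.2 ht0)
  simp only [zero_mul, add_zero, mul_zero, norm_le_zero_iff, sub_eq_zero] at key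
  rw [key]

end NicholsonSystem

/-! ### The skew-product semiflow -/

namespace NicholsonSystem

variable {m : ℕ} {S : NicholsonSystem m}

/-- The nonnegative solution with coefficients `ω` and initial value `φ`. -/
noncomputable def solution (hS : S.Assumptions) (ω : S.Hull) (φ : S.PosCone) : ℝ → Fin m → ℝ :=
  (exists_isPosSolution hS ω φ).choose

theorem isPosSolution_solution (hS : S.Assumptions) (ω : S.Hull) (φ : S.PosCone) :
    IsPosSolution ω φ (solution hS ω φ) :=
  (exists_isPosSolution hS ω φ).choose_spec

theorem eventually_norm_vectorField_sub_lt (ω₀ : S.Hull) (T : ℝ) {x z : ℝ → Fin m → ℝ}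
    (hx : Continuous x) (hz : Continuous z) {η : ℝ} (hη : 0 < η) :
    ∀ᶠ ω : S.Hull in 𝓝 ω₀, ∀ t ∈ Icc 0 T,
      ‖vectorField (ω.1 t) (x t) (x t) (z t) - vectorField (ω₀.1 t) (x t) (x t) (z t)‖ < η := by
  have hc1 : Continuous fun p : S.Hull × ℝ =>
      vectorField (p.1.1 p.2) (x p.2) (x p.2) (z p.2) :=
    continuous_vectorField.comp (continuous_eval_hull.prodMk
      ((hx.comp continuous_snd).prodMk ((hx.comp continuous_snd).prodMk (hz.comp continuous_snd))))
  have hc2 : Continuous fun p : S.Hull × ℝ =>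
      vectorField (ω₀.1 p.2) (x p.2) (x p.2) (z p.2) :=
    hc1.comp (continuous_const.prodMk continuous_snd)
  have hc : Continuous fun p : S.Hull × ℝ => ‖vectorField (p.1.1 p.2) (x p.2) (x p.2) (z p.2)
      - vectorField (ω₀.1 p.2) (x p.2) (x p.2) (z p.2)‖ := (hc1.sub hc2).norm
  have hev : ∀ t ∈ Icc 0 T, ∀ᶠ p : S.Hull × ℝ in 𝓝 (ω₀, t),
      ‖vectorField (p.1.1 p.2) (x p.2) (x p.2) (z p.2)
        - vectorField (ω₀.1 p.2) (x p.2) (x p.2) (z p.2)‖ < η := by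
    intro t _
    have h2 := hc.tendsto (ω₀, t)
    simp only [sub_self, norm_zero] at h2
    exact h2.eventually_lt_const hη
  exact isCompact_Icc.eventually_forall_of_forall_eventually hev

/-- Continuous dependence, uniformly on `(-∞, T]`. The error made by changing `ω` in the vector
field along the reference solution is uniformly small on `[0, T]` by compactness, and the delayed
Grönwall inequality does the rest. -/
theorem eventually_norm_solution_sub_lt (hS : S.Assumptions) (q₀ : S.Hull × S.PosCone) {T ε : ℝ}
    (hT : 0 ≤ T) (hε : 0 < ε) : ∀ᶠ q in 𝓝 q₀, ∀ t ≤ T,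
      ‖solution hS q.1 q.2 t - solution hS q₀.1 q₀.2 t‖ < ε := by
  obtain ⟨M, c₀, hM, hc₀, hB⟩ := hS.exists_coeffBounds
  have hL := lipConst_pos (m := m) hM le_rfl
  set L := lipConst m M 0
  set C := 3 * (1 + T) * Real.exp (4 * L * T) with hC
  have hC1 : 1 ≤ C := by
    have : 1 ≤ Real.exp (4 * L * T) := Real.one_le_exp (by positivity)
    nlinarith
  set η := ε / (2 * C) with hη
  have hη0 : 0 < η := by positivity
  have hηC : η * C = ε / 2 := by rw [hη]; field_simp
  have h0 := isPosSolution_solution hS q₀.1 q₀.2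
  set Y₀ := solution hS q₀.1 q₀.2
  have hdist : ∀ᶠ q in 𝓝 q₀, dist q.2.1 q₀.2.1 < η := by
    have h1 : Tendsto (fun q : S.Hull × S.PosCone => dist q.2.1 q₀.2.1) (𝓝 q₀) (𝓝 0) := by
      have : Continuous fun q : S.Hull × S.PosCone => dist q.2.1 q₀.2.1 := by fun_prop
      simpa using this.tendsto q₀
    exact h1.eventually_lt_const hη0
  have hcoeff : ∀ᶠ q in 𝓝 q₀, ∀ t ∈ Icc 0 T,
      ‖vectorField (q.1.1 t) (Y₀ t) (Y₀ t) (delayed S.r Y₀ t)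
        - vectorField (q₀.1.1 t) (Y₀ t) (Y₀ t) (delayed S.r Y₀ t)‖ < η := by
    exact (continuous_fst.tendsto q₀).eventually (eventually_norm_vectorField_sub_lt q₀.1 T
      h0.continuous (continuous_delayed h0.continuous) hη0)
  filter_upwards [hdist, hcoeff] with q hq1 hq2 t ht
  have h := isPosSolution_solution hS q.1 q.2
  set Y := solution hS q.1 q.2
  have hinit : ∀ t ≤ 0, ‖Y t - Y₀ t‖ ≤ η := fun t ht => by
    rw [h.initial t ht, h0.initial t ht]
    exact (norm_history_sub_le _ _ _).trans hq1.le
  rcases le_total t 0 with ht0 | ht0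
  · have := hinit t ht0
    nlinarith
  · have key := norm_le_of_norm_deriv_le_delayed (r := S.r) (fun i => (S.r_pos i).le)
      (w := fun t => Y t - Y₀ t) (T := T) hL hη0.le hη0.le (h.continuous.sub h0.continuous) hinit
      (fun s hs => (h.deriv s hs.1).sub (h0.deriv s hs.1))
      (fun s hs => by
        have h1 := norm_vectorField_sub_le (R := 0) hM hc₀ le_rfl (hB q.1 s)
          (x := Y s) (v := Y s) (z := delayed S.r Y s) (x' := Y₀ s) (v' := Y₀ s)
          (z' := delayed S.r Y₀ s) le_rfl (fun i => neg_zero.le.trans (h.nonneg _ i))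
          (fun i => neg_zero.le.trans (h0.nonneg _ i))
        have h2 := hq2 s ⟨hs.1, hs.2.le⟩
        refine (norm_sub_le_norm_sub_add_norm_sub _
          (vectorField (q.1.1 s) (Y₀ s) (Y₀ s) (delayed S.r Y₀ s)) _).trans ?_
        exact add_le_add h1 h2.le) t ⟨ht0, ht⟩
    have h3 : Real.exp (4 * L * t) ≤ Real.exp (4 * L * T) := by gcongr
    calc ‖Y t - Y₀ t‖ ≤ 3 * (η + η * T) * Real.exp (4 * L * t) := key
      _ ≤ 3 * (η + η * T) * Real.exp (4 * L * T) := by gcongr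
      _ = η * C := by rw [hC]; ring
      _ < ε := by rw [hηC]; linarith

theorem continuous_solution (hS : S.Assumptions) :
    Continuous fun p : (S.Hull × S.PosCone) × ℝ => solution hS p.1.1 p.1.2 p.2 := by
  rw [continuous_iff_continuousAt]
  rintro ⟨q₀, t₀⟩
  rw [Metric.continuousAt_iff']
  intro ε hε
  have h1 := eventually_norm_solution_sub_lt hS q₀ (T := |t₀| + 1) (by positivity) (half_pos hε)
  have h2 := Metric.continuousAt_iff'.1
    ((isPosSolution_solution hS q₀.1 q₀.2).continuous.continuousAt (x := t₀)) (ε / 2) (half_pos hε)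
  have h3 : ∀ᶠ t in 𝓝 t₀, t < |t₀| + 1 := eventually_lt_nhds (by linarith [le_abs_self t₀])
  rw [nhds_prod_eq]
  filter_upwards [h1.prod_mk (h2.and h3)] with ⟨q, t⟩ ⟨hq, ht, ht'⟩
  have h4 := hq t ht'.le
  rw [← dist_eq_norm] at h4
  have := dist_triangle (solution hS q.1 q.2 t) (solution hS q₀.1 q₀.2 t)
    (solution hS q₀.1 q₀.2 t₀)
  simp only at h4 ht ⊢
  linarith

/-- The history segment `y_t(ω, φ)`, a point of the positive cone. -/
noncomputable def historySegment (hS : S.Assumptions) (t : ℝ≥0) (ω : S.Hull) (φ : S.PosCone) :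
    S.PosCone :=
  ⟨fun i => ⟨fun s => solution hS ω φ (t + s) i, by
      have := (isPosSolution_solution hS ω φ).continuous
      fun_prop⟩,
    fun i _ => (isPosSolution_solution hS ω φ).nonneg _ i⟩

/-- The semiflow induced by the solutions. -/
noncomputable def semiflow (hS : S.Assumptions) (t : ℝ≥0) (p : S.Hull × S.PosCone) :
    S.Hull × S.PosCone :=
  (S.shift t p.1, historySegment hS t p.1 p.2)

theorem isInducedSemiflow_semiflow (hS : S.Assumptions) : S.IsInducedSemiflow (semiflow hS) where
  exists_solution ω φ := ⟨_, (isPosSolution_solution hS ω φ).isSolution⟩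
  base _ _ _ := rfl
  segment ω φ y hy t i s :=
    (hy.eq_of_isPosSolution hS (isPosSolution_solution hS ω φ) i
      (by have := s.2.1; have := t.2; linarith)).symm

theorem isSolution_solution_add (hS : S.Assumptions) (s : ℝ≥0) (ω : S.Hull) (φ : S.PosCone) :
    S.IsSolution (S.shift s ω) (historySegment hS s ω φ).1
      fun i u => solution hS ω φ (s + u) i := by
  have h := isPosSolution_solution hS ω φ
  refine ⟨fun i => ?_, fun i u => rfl, fun i t ht => ?_⟩
  · have := h.continuous
    exact Continuous.continuousOn (by fun_prop)
  · have hs : (0 : ℝ) ≤ s := s.2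
    have h1 := (hasDerivWithinAt_pi.1 (h.deriv (s + t) (add_nonneg hs ht))) i
    have h2 := h1.scomp t (((hasDerivAt_id t).const_add (s : ℝ)).hasDerivWithinAt (s := Ici 0))
      (fun u hu => add_nonneg hs hu)
    refine h2.congr_deriv ?_
    simp [vectorField, hullD, hullA, hullB, hullC, shift_apply, delayed, add_sub_assoc]

theorem solution_shift (hS : S.Assumptions) (s : ℝ≥0) (ω : S.Hull) (φ : S.PosCone) (i : Fin m)
    {u : ℝ} (hu : -S.r i ≤ u) :
    solution hS (S.shift s ω) (historySegment hS s ω φ) u i = solution hS ω φ (s + u) i :=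
  ((isSolution_solution_add hS s ω φ).eq_of_isPosSolution hS
    (isPosSolution_solution hS _ _) i hu).symm

theorem isSkewProductSemiflow_semiflow (hS : S.Assumptions) :
    IsSkewProductSemiflow S.shift (semiflow hS) where
  compact_base := isCompact_iff_compactSpace.1 hS.isCompact_hullSet
  base_flow := isContinuousFlow_shift S
  continuous := by
    refine Continuous.prodMk ?_ ?_
    · exact (isContinuousFlow_shift S).continuous.comp
        (f := fun p : ℝ≥0 × (S.Hull × S.PosCone) => ((p.1 : ℝ), p.2.1)) (by fun_prop)
    · refine Continuous.subtype_mk (continuous_pi fun i =>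
        ContinuousMap.continuous_of_continuous_uncurry _ ?_) _
      exact (continuous_apply i).comp ((continuous_solution hS).comp
        (f := fun z : (ℝ≥0 × (S.Hull × S.PosCone)) × Icc (-S.r i) 0 =>
          (z.1.2, (z.1.1 : ℝ) + z.2)) (by fun_prop))
  fst_eq _ _ := rfl
  zero p := by
    refine Prod.ext ((isContinuousFlow_shift S).zero p.1) (Subtype.ext (funext fun i =>
      ContinuousMap.ext fun s => ?_))
    change solution hS p.1 p.2 (((0 : ℝ≥0) : ℝ) + s) i = p.2.1 i s
    rw [NNReal.coe_zero, zero_add, (isPosSolution_solution hS p.1 p.2).initial s s.2.2, history,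
      projIcc_val]
  add t s p := by
    refine Prod.ext ?_ (Subtype.ext (funext fun i => ContinuousMap.ext fun u => ?_))
    · change S.shift ((t + s : ℝ≥0) : ℝ) p.1 = S.shift t (S.shift s p.1)
      rw [NNReal.coe_add, (isContinuousFlow_shift S).add]
    · change solution hS p.1 p.2 (((t + s : ℝ≥0) : ℝ) + u) i =
        solution hS (S.shift s p.1) (historySegment hS s p.1 p.2) (t + u) i
      have h1 : -S.r i ≤ t + u := by
        have := u.2.1
        have := t.2
        linarith
      rw [solution_shift hS s p.1 p.2 i h1]
      congr 1
      push_cast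
      ring

end NicholsonSystem

/-! ### Dissipation and the compact absorbing set -/

theorem isCompact_setOf_lipschitzWith {X : Type*} [MetricSpace X] (R : ℝ)
    (Λ : ℝ≥0) : IsCompact {g : C(X, ℝ) | (∀ s, g s ∈ Icc 0 R) ∧ LipschitzWith Λ g} := by
  refine ArzelaAscoli.isCompact_of_equicontinuous _ ?_ ?_
  · have h1 : ContinuousMap.toFun '' {g : C(X, ℝ) | (∀ s, g s ∈ Icc 0 R) ∧ LipschitzWith Λ g}
        = (univ.pi fun _ => Icc 0 R) ∩ {f : X → ℝ | LipschitzWith Λ f} := by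
      ext f
      constructor
      · rintro ⟨g, hg, rfl⟩
        exact ⟨fun s _ => hg.1 s, hg.2⟩
      · rintro ⟨hf, hf'⟩
        exact ⟨⟨f, LipschitzWith.continuous hf'⟩, ⟨fun s => hf s trivial, hf'⟩, rfl⟩
    rw [h1]
    exact (isCompact_univ_pi fun _ => isCompact_Icc).inter_right (isClosed_setOfPred_lipschitzWith Λ)
  · exact (LipschitzWith.uniformEquicontinuous _ Λ fun g => g.2.2).equicontinuous

namespace NicholsonSystem

variable {m : ℕ} {S : NicholsonSystem m}

/-- The dominance margin `dᵢ - ∑ⱼ aⱼᵢ` has infimum possibly zero, but all the margins are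
simultaneously bounded below on intervals of a fixed length that recur within bounded times: the
coefficients are jointly almost periodic and all the margins are positive at time `0`. The property
is closed, so it passes to the hull. -/
theorem Assumptions.exists_recurrent_dominance (hS : S.Assumptions) :
    ∃ L h η : ℝ, 0 < L ∧ 0 < h ∧ 0 < η ∧ ∀ ω : S.Hull, ∃ s ∈ Icc 0 L, ∀ u ∈ Icc 0 h, ∀ i,
      η ≤ (ω.1 (s + u)).1 i - ∑ j, (ω.1 (s + u)).2.1 j i := by
  obtain ⟨η, hη, hη0⟩ : ∃ η : ℝ, (∀ i, η < S.d i 0 - ∑ j, S.a j i 0) ∧ 0 < η := by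
    have h1 : ∀ᶠ η : ℝ in 𝓝[>] 0, ∀ i, η < S.d i 0 - ∑ j, S.a j i 0 :=
      eventually_all.2 fun i => nhdsWithin_le_nhds (eventually_lt_nhds (hS.dominance i 0))
    exact (h1.and self_mem_nhdsWithin).exists
  have hUo : IsOpen {p : NicholsonCoeff m | ∀ i, η < p.1 i - ∑ j, p.2.1 j i} := by
    simp only [ofPred_forall]
    exact isOpen_iInter_of_finite fun i => isOpen_lt (by fun_prop) (by fun_prop)
  obtain ⟨ε, hε, hball⟩ := Metric.isOpen_iff.1 hUo (S.coeffMap 0) hη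
  obtain ⟨h, hh, hunif⟩ := Metric.uniformContinuous_iff.1 hS.uniformContinuous (ε / 2) (half_pos hε)
  obtain ⟨L, hL, hP⟩ := hS.hasPrecompactTranslates.relativelyDense (half_pos hε)
  refine ⟨L, h / 2, η, hL, half_pos hh, hη0, fun ω => ?_⟩
  let D : Set (Icc (0 : ℝ) L × C(ℝ, NicholsonCoeff m)) := {p | ∀ u ∈ Icc 0 (h / 2), ∀ i,
    η ≤ (p.2 (p.1 + u)).1 i - ∑ j, (p.2 (p.1 + u)).2.1 j i}
  have hD : IsClosed D := by
    simp only [D, ofPred_forall]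
    exact isClosed_iInter fun u => isClosed_iInter fun _ => isClosed_iInter fun i =>
      isClosed_le (by fun_prop) (by fun_prop)
  obtain ⟨⟨s, f⟩, hs, rfl⟩ := mem_of_forall_translate_mem (isClosedMap_snd_of_compactSpace D hD)
    (fun t => by
      obtain ⟨s, hs, h1, h2⟩ := hP t
      refine ⟨(⟨s - t, by linarith, by linarith⟩, translate t S.coeffMap), fun u hu i => ?_, rfl⟩
      have h3 : dist (S.coeffMap (s + u)) (S.coeffMap s) < ε / 2 :=
        hunif (by
          rw [Real.dist_eq, add_sub_cancel_left, abs_of_nonneg hu.1]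
          linarith [hu.2])
      have h4 := hs 0
      rw [zero_add] at h4
      have h5 : S.coeffMap (s + u) ∈ Metric.ball (S.coeffMap 0) ε :=
        (dist_triangle _ _ _).trans_lt (by linarith)
      have h6 := (hball h5 i).le
      have h7 : translate t S.coeffMap (s - t + u) = S.coeffMap (s + u) := by
        change S.coeffMap (t + (s - t + u)) = _
        congr 1
        ring
      simp only [h7]
      exact h6) ω
  exact ⟨s, s.2, hs⟩

theorem ricker_le {c c₀ z : ℝ} (hc₀ : 0 < c₀) (hc : c₀ ≤ c) (hz : 0 ≤ z) :
    z * Real.exp (-c * z) ≤ 1 / c₀ := by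
  have h1 : c₀ * z ≤ Real.exp (c * z) := by
    have := Real.add_one_le_exp (c * z)
    nlinarith
  rw [neg_mul, Real.exp_neg, ← div_eq_mul_inv, div_le_div_iff₀ (Real.exp_pos _) hc₀]
  linarith

/-- Summing the components, the coupling terms are absorbed by the decay terms. -/
theorem sum_vectorField_le {M c₀ η : ℝ} (hM : 0 < M) (hc₀ : 0 < c₀) {p : NicholsonCoeff m}
    (hp : CoeffBounds M c₀ p) (hη : ∀ i, η ≤ p.1 i - ∑ j, p.2.1 j i) {x z : Fin m → ℝ}
    (hx : ∀ i, 0 ≤ x i) (hz : ∀ i, 0 ≤ z i) :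
    ∑ i, vectorField p x x z i ≤ -η * ∑ i, x i + m * (M * (1 / c₀)) := by
  have h1 : ∑ i, vectorField p x x z i = ∑ i, -((p.1 i - ∑ j, p.2.1 j i) * x i)
      + ∑ i, p.2.2.1 i * (z i * Real.exp (-p.2.2.2 i * z i)) := by
    have hcomm : ∑ i, ∑ j, p.2.1 i j * x j = ∑ i, (∑ j, p.2.1 j i) * x i := by
      rw [Finset.sum_comm]
      simp only [Finset.sum_mul]
    simp only [vectorField, Finset.sum_add_distrib, hcomm, sub_mul, neg_sub, mul_assoc,
      Finset.sum_sub_distrib, neg_mul, Finset.sum_neg_distrib]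
    ring
  rw [h1, Finset.mul_sum]
  refine add_le_add (Finset.sum_le_sum fun i _ => ?_) ?_
  · have := mul_le_mul_of_nonneg_right (hη i) (hx i)
    linarith
  · refine (Finset.sum_le_card_nsmul _ _ (M * (1 / c₀)) fun i _ => ?_).trans (by simp)
    have := hz i
    exact mul_le_mul (le_of_abs_le (hp.β_le i)) (ricker_le hc₀ (hp.c_ge i) (hz i))
      (by positivity) hM.le

theorem abs_vectorField_le {M c₀ R : ℝ} (hM : 0 < M) (hc₀ : 0 < c₀) {p : NicholsonCoeff m}
    (hp : CoeffBounds M c₀ p) {x z : Fin m → ℝ} (hx : ∀ i, |x i| ≤ R) (hz : ∀ i, 0 ≤ z i)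
    (i : Fin m) : |vectorField p x x z i| ≤ M * R + m * (M * R) + M * (1 / c₀) := by
  refine (abs_add_three _ _ _).trans (add_le_add (add_le_add ?_ ?_) ?_)
  · rw [abs_mul, abs_neg]
    exact mul_le_mul (hp.d_le i) (hx i) (abs_nonneg _) hM.le
  · refine (Finset.abs_sum_le_sum_abs _ _).trans ?_
    refine (Finset.sum_le_card_nsmul _ _ (M * R) fun j _ => ?_).trans (by simp)
    rw [abs_mul]
    exact mul_le_mul (hp.a_le i j) (hx j) (abs_nonneg _) hM.le
  · have := hz i
    rw [mul_assoc, abs_mul, abs_of_nonneg (a := z i * _) (by positivity)]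
    exact mul_le_mul (hp.β_le i) (ricker_le hc₀ (hp.c_ge i) (hz i)) (by positivity) hM.le

/-- Over a time window of a fixed length, the total population contracts by a fixed factor up to an
additive constant. Outside the recurrent intervals where all the dominance margins are at least
`η`, it only grows at bounded rate. -/
theorem exists_sum_solution_window (hS : S.Assumptions) :
    ∃ q C W : ℝ, 0 < q ∧ q < 1 ∧ 0 ≤ C ∧ 0 < W ∧ ∀ (ω : S.Hull) (φ : S.PosCone) (t₀ : ℝ),
      0 ≤ t₀ → ∑ i, solution hS ω φ (t₀ + W) i ≤ q * ∑ i, solution hS ω φ t₀ i + C ∧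
        ∀ t ∈ Icc t₀ (t₀ + W), ∑ i, solution hS ω φ t i ≤ ∑ i, solution hS ω φ t₀ i + C := by
  obtain ⟨M, c₀, hM, hc₀, hB⟩ := hS.exists_coeffBounds
  obtain ⟨L, h, η, hL, hh, hη, hrec⟩ := hS.exists_recurrent_dominance
  set K := m * (M * (1 / c₀)) with hK
  have hK0 : 0 ≤ K := by positivity
  have hηh : 0 < η * h := by positivity
  refine ⟨1 / (1 + η * h), 2 * K * (L + h), L + h, by positivity,
    (div_lt_one (by positivity)).2 (by linarith), by positivity, by positivity,
    fun ω φ t₀ ht₀ => ?_⟩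
  have hsol := isPosSolution_solution hS ω φ
  set Y := solution hS ω φ
  set V : ℝ → ℝ := fun t => ∑ i, Y t i with hV
  have hVc : Continuous V := by
    have := hsol.continuous
    fun_prop
  have hVd : ∀ t, 0 ≤ t → HasDerivWithinAt V
      (∑ i, vectorField (ω.1 t) (Y t) (Y t) (delayed S.r Y t) i) (Ici 0) t := fun t ht =>
    HasDerivWithinAt.fun_sum fun i _ => (hasDerivWithinAt_pi.1 (hsol.deriv t ht)) i
  have hVd_le : ∀ η' t, (∀ i, η' ≤ (ω.1 t).1 i - ∑ j, (ω.1 t).2.1 j i) →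
      ∑ i, vectorField (ω.1 t) (Y t) (Y t) (delayed S.r Y t) i ≤ -η' * V t + K := fun η' t hη' =>
    sum_vectorField_le hM hc₀ (hB ω t) hη' (hsol.nonneg t) fun i => hsol.nonneg _ i
  have hgrow : ∀ a b, 0 ≤ a → a ≤ b → V b ≤ V a + K * (b - a) := fun a b ha hab =>
    le_add_mul_of_deriv_le hVc ha hVd (fun t _ => by
      simpa using hVd_le 0 t fun i => sub_nonneg.2 ((hB ω t).dominance i)) b ⟨hab, le_rfl⟩
  obtain ⟨s, hs, hdom⟩ := hrec (S.shift t₀ ω)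
  have hKLh : 0 ≤ K * L := by positivity
  have hKh : 0 ≤ K * h := by positivity
  constructor
  · change V (t₀ + (L + h)) ≤ _ * V t₀ + _
    have ha : 0 ≤ t₀ + s := add_nonneg ht₀ hs.1
    -- on the interval `[t₀ + s, t₀ + s + h]`, `V` is at least `V (t₀ + s + h) - K * h`, which
    -- bounds its derivative from above
    have h1 := le_add_mul_of_deriv_le (a := t₀ + s) (b := t₀ + s + h)
      (C := -η * (V (t₀ + s + h) - K * h) + K) hVc ha hVd (fun t ht => by
        have h2 := hgrow t (t₀ + s + h) (ha.trans ht.1) ht.2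
        have h3 : K * (t₀ + s + h - t) ≤ K * h :=
          mul_le_mul_of_nonneg_left (by linarith [ht.1]) hK0
        refine (hVd_le η t fun i => ?_).trans ?_
        · have h4 := hdom (t - (t₀ + s)) ⟨by linarith [ht.1], by linarith [ht.2]⟩ i
          rw [shift_apply, show t₀ + (s + (t - (t₀ + s))) = t by ring] at h4
          exact h4
        · nlinarith) (t₀ + s + h) ⟨by linarith, le_rfl⟩
    have h2 := hgrow t₀ (t₀ + s) ht₀ (by linarith [hs.1])
    have h3 := hgrow (t₀ + s + h) (t₀ + (L + h)) (by linarith) (by linarith [hs.2])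
    have h4 : V (t₀ + s + h) ≤ 1 / (1 + η * h) * V (t₀ + s) + K * h := by
      rw [div_mul_eq_mul_div, one_mul, ← sub_le_iff_le_add, le_div_iff₀ (by positivity)]
      linarith
    have h5 : 1 / (1 + η * h) * V (t₀ + s) ≤ 1 / (1 + η * h) * V t₀ + K * s := by
      have h6 : 1 / (1 + η * h) ≤ 1 := (div_le_one (by positivity)).2 (by linarith)
      have h7 : 0 < 1 / (1 + η * h) := by positivity
      have h8 : 0 ≤ K * s := mul_nonneg hK0 hs.1
      have h9 : V (t₀ + s) ≤ V t₀ + K * s := by linarith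
      nlinarith
    linarith
  · intro t ht
    have h1 := hgrow t₀ t ht₀ ht.1
    have h2 : K * (t - t₀) ≤ K * (L + h) := mul_le_mul_of_nonneg_left (by linarith [ht.2]) hK0
    change V t ≤ V t₀ + _
    linarith

/-- Uniform ultimate boundedness. -/
theorem exists_absorbing_bound (hS : S.Assumptions) : ∃ R : ℝ, 0 < R ∧ ∀ B : ℝ, ∃ T : ℝ, 0 ≤ T ∧
    ∀ (ω : S.Hull) (φ : S.PosCone), ‖φ.1‖ ≤ B → ∀ t, T ≤ t → ∀ i, solution hS ω φ t i ≤ R := by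
  obtain ⟨q, C, W, hq0, hq1, hC, hW, hwin⟩ := exists_sum_solution_window hS
  have h1q : 0 < 1 - q := by linarith
  refine ⟨1 + C / (1 - q) + C, by positivity, fun B => ?_⟩
  obtain ⟨n₀, hn₀⟩ : ∃ n : ℕ, q ^ n * (m * |B|) < 1 := by
    have h1 := (tendsto_pow_atTop_nhds_zero_of_lt_one hq0.le hq1).mul_const (m * |B|)
    rw [zero_mul] at h1
    exact (h1.eventually_lt_const one_pos).exists
  refine ⟨n₀ * W, by positivity, fun ω φ hφ t ht i => ?_⟩
  have hsol := isPosSolution_solution hS ω φ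
  have hwin' := hwin ω φ
  set Y := solution hS ω φ
  have hV0 : ∑ i, Y 0 i ≤ m * |B| := by
    refine (Finset.sum_le_card_nsmul _ _ |B| fun i _ => ?_).trans (by simp)
    rw [hsol.initial 0 le_rfl]
    exact (le_abs_self _).trans ((norm_le_pi_norm _ i).trans
      ((norm_history_le _ _).trans (hφ.trans (le_abs_self B))))
  have hiter : ∀ n : ℕ, ∑ i, Y (n * W) i ≤ q ^ n * (m * |B|) + C / (1 - q) := by
    intro n
    induction n with
    | zero =>
      simp only [Nat.cast_zero, zero_mul, pow_zero, one_mul]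
      have : 0 ≤ C / (1 - q) := by positivity
      linarith
    | succ n ih =>
      have h1 := (hwin' (n * W) (by positivity)).1
      have h2 : C / (1 - q) = q * (C / (1 - q)) + C := by field_simp; ring
      rw [show ((n + 1 : ℕ) : ℝ) * W = n * W + W by push_cast; ring, h2, pow_succ]
      nlinarith
  have ht0 : 0 ≤ t := le_trans (by positivity) ht
  set n := ⌊t / W⌋₊ with hn
  have hn1 : n * W ≤ t := (le_div_iff₀ hW).1 (Nat.floor_le (by positivity))
  have hn2 : t ≤ n * W + W := by
    have := ((div_lt_iff₀ hW).1 (Nat.lt_floor_add_one (t / W))).le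
    linarith
  have hn3 : n₀ ≤ n := Nat.le_floor ((le_div_iff₀ hW).2 ht)
  have h1 := (hwin' (n * W) (by positivity)).2 t ⟨hn1, hn2⟩
  have h2 := hiter n
  have h3 : q ^ n * (m * |B|) ≤ q ^ n₀ * (m * |B|) :=
    mul_le_mul_of_nonneg_right (pow_le_pow_of_le_one hq0.le hq1.le hn3) (by positivity)
  have h4 : Y t i ≤ ∑ i, Y t i :=
    Finset.single_le_sum (f := fun i => Y t i) (fun i _ => hsol.nonneg t i) (Finset.mem_univ i)
  linarith

/-- The states with values in `[0, R]` that are `Λ`-Lipschitz. -/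
def lipschitzStates (S : NicholsonSystem m) (R : ℝ) (Λ : ℝ≥0) : Set S.PosCone :=
  {φ | ∀ i, (∀ s, φ.1 i s ∈ Icc 0 R) ∧ LipschitzWith Λ (φ.1 i)}

theorem isCompact_lipschitzStates (R : ℝ) (Λ : ℝ≥0) : IsCompact (S.lipschitzStates R Λ) := by
  have h1 : IsClosed {φ : S.StateSpace | ∀ i s, 0 ≤ φ i s} := by
    simp only [ofPred_forall]
    exact isClosed_iInter fun i => isClosed_iInter fun s => isClosed_le (by fun_prop) (by fun_prop)
  have h2 := h1.isClosedEmbedding_subtypeVal.isCompact_preimage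
    (isCompact_univ_pi fun i : Fin m => isCompact_setOf_lipschitzWith (X := Icc (-S.r i) 0) R Λ)
  have h3 : S.lipschitzStates R Λ = Subtype.val ⁻¹' univ.pi fun i =>
      {g : C(Icc (-S.r i) 0, ℝ) | (∀ s, g s ∈ Icc 0 R) ∧ LipschitzWith Λ g} := by
    ext φ
    exact ⟨fun h i _ => h i, fun h i => h i trivial⟩
  rw [h3]
  exact h2

/-- The history segments of bounded sets of initial values end up in a compact set of Lipschitz
functions: once a solution is bounded, so is its derivative, the delayed term being bounded in any
case. The bound has to hold during one maximal delay before the segment is Lipschitz. -/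
theorem exists_absorbing_lipschitzStates (hS : S.Assumptions) : ∃ (R : ℝ) (Λ : ℝ≥0), 0 < R ∧
    ∀ B : ℝ, ∃ T : ℝ≥0, ∀ t, T ≤ t → ∀ (ω : S.Hull) (φ : S.PosCone), ‖φ.1‖ ≤ B →
      historySegment hS t ω φ ∈ S.lipschitzStates R Λ := by
  obtain ⟨M, c₀, hM, hc₀, hB⟩ := hS.exists_coeffBounds
  obtain ⟨R, hR, habs⟩ := exists_absorbing_bound hS
  have hΛ : 0 ≤ M * R + m * (M * R) + M * (1 / c₀) := by positivity
  refine ⟨R, ⟨_, hΛ⟩, hR, fun B => ?_⟩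
  obtain ⟨T, hT0, hT⟩ := habs B
  have hr0 : 0 ≤ ∑ i, S.r i := Finset.sum_nonneg fun i _ => (S.r_pos i).le
  refine ⟨⟨T + ∑ i, S.r i, by positivity⟩, fun t ht ω φ hφ i => ?_⟩
  have hsol := isPosSolution_solution hS ω φ
  have hle := hT ω φ hφ
  have ht' : T + ∑ i, S.r i ≤ t := ht
  have hmem : ∀ s : Icc (-S.r i) 0, (t : ℝ) + s ∈ Ici T := fun s => by
    have h1 := s.2.1
    have h2 : S.r i ≤ ∑ i, S.r i :=
      Finset.single_le_sum (fun i _ => (S.r_pos i).le) (Finset.mem_univ i)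
    rw [mem_Ici]
    linarith
  refine ⟨fun s => ⟨hsol.nonneg _ i, hle _ (hmem s) i⟩, LipschitzWith.of_dist_le_mul fun s s' => ?_⟩
  have h1 := Convex.norm_image_sub_le_of_norm_hasDerivWithin_le (s := Ici T)
    (f := fun t => solution hS ω φ t i)
    (fun u hu => ((hasDerivWithinAt_pi.1 (hsol.deriv u (hT0.trans hu))) i).mono
      (Ici_subset_Ici.2 hT0))
    (fun u hu => abs_vectorField_le hM hc₀ (hB ω u)
      (fun j => by rw [abs_of_nonneg (hsol.nonneg u j)]; exact hle u hu j)
      (fun j => hsol.nonneg _ j) i) (convex_Ici T) (hmem s') (hmem s)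
  rw [add_sub_add_left_eq_sub] at h1
  exact h1

end NicholsonSystem

theorem theorem3p1 {m : ℕ} (S : NicholsonSystem m) (hS : S.Assumptions) :
    ∃ τ : ℝ≥0 → S.Hull × S.PosCone → S.Hull × S.PosCone,
      S.IsInducedSemiflow τ ∧ IsSkewProductSemiflow S.shift τ ∧
      ∃ A : Set (S.Hull × S.PosCone),
        IsGlobalAttractor τ {X₁ : Set S.PosCone | Bornology.IsBounded X₁} A := by
  have hflow := NicholsonSystem.isSkewProductSemiflow_semiflow hS
  refine ⟨NicholsonSystem.semiflow hS, NicholsonSystem.isInducedSemiflow_semiflow hS, hflow, ?_⟩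
  obtain ⟨R, Λ, hR, habs⟩ := NicholsonSystem.exists_absorbing_lipschitzStates hS
  have := hflow.compact_base
  refine hflow.exists_isGlobalAttractor (K := univ ×ˢ S.lipschitzStates R Λ)
    (isCompact_univ.prod (NicholsonSystem.isCompact_lipschitzStates R Λ)) ?_ ?_
  · obtain ⟨T, hT⟩ := habs R
    filter_upwards [eventually_ge_atTop T] with t ht
    rintro ⟨ω, φ⟩ ⟨-, hφ⟩
    refine ⟨trivial, hT t ht ω φ ((pi_norm_le_iff_of_nonneg hR.le).2 fun i =>
      (ContinuousMap.norm_le _ hR.le).2 fun s => ?_)⟩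
    have h1 := (hφ i).1 s
    rw [Real.norm_of_nonneg h1.1]
    exact h1.2
  · intro X₁ (hX₁ : Bornology.IsBounded X₁)
    obtain ⟨B, hB⟩ := hX₁.subset_closedBall (⟨0, fun _ _ => le_rfl⟩ : S.PosCone)
    obtain ⟨T, hT⟩ := habs B
    refine ⟨T, ?_⟩
    rintro ⟨ω, φ⟩ ⟨-, hφ⟩
    refine ⟨trivial, hT T le_rfl ω φ ?_⟩
    have h1 := hB hφ
    rw [Metric.mem_closedBall, Subtype.dist_eq, dist_zero_right] at h1
    exact h1
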